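/- All simplicial complexes are finite and abstract, with vertices in a fixed infinite set, and the empty set is counted as a face. For a field $\mathbb F$, an $\mathbb F$-homology $d$-sphere is a $d$-dimensional complex in which the link of every face $\sigma$ (including $\emptyset$) has the reduced $\mathbb F$-homology of a sphere of dimension $d-\#\sigma$. The boundary $\partial B$ of a $(d+1)$-dimensional complex $B$ is the pure subcomplex whose facets are the $d$-faces of $B$ lying in exactly one $(d+1)$-face; $B$ is an $\mathbb F$-homology $(d+1)$-ball if $\partial B$ is an $\mathbb F$-homology $d$-sphere, the link of every face $\sigma\in\partial B$ (including $\emptyset$) is $\mathbb F$-acyclic, and the link of every face $\sigma\in B\setminus\partial B$ has the reduced $\mathbb F$-homology of a sphere of dimension $d+1-\#\sigma$. A homology sphere (ball) is an $\mathbb F$-homology sphere (ball) for some field $\mathbb F$. A homology $(d+1)$-ball $B$ is $k$-stacked if all its faces of dimension $\le d-k$ lie in $\partial B$; a homology $d$-sphere $S$ is $k$-stacked if $S=\partial B$ for some $k$-stacked homology $(d+1)$-ball $B$. Let $\mathcal S_k(d)$ be the class of $k$-stacked homology $d$-spheres. If a $d$-dimensional complex $X$ has disjoint non-empty vertex sets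 $\alpha,\beta$ with $\#\alpha+\#\beta=d+2$ such that the subcomplex of $X$ induced on $\alpha\sqcup\beta$ is $\overline\alpha*\partial\beta$ (where $\overline\alpha$ is the full simplex on $\alpha$ and $\partial\beta$ is the complex of proper subsets of $\beta$), then the bistellar move $\alpha\mapsto\beta$, of index $\#\beta-1$, replaces $X$ by $(X\setminus(\overline\alpha*\partial\beta))\cup(\partial\alpha*\overline\beta)$. A $d$-dimensional complex is $k$-stellated if it is obtained from the standard $d$-sphere (all proper subsets of a set of $d+2$ vertices) by finitely many bistellar moves of index $<k$. Let $\Sigma_k(d)$ be the class of $k$-stellated complexes of dimension $d$. For $d\ge1$ let $\mathcal W_k(d)$ (respectively $\mathcal K_k(d)$) be the class of connected $d$-dimensional complexes all of whose vertex links belong to $\Sigma_k(d-1)$ (respectively $\mathcal S_k(d-1)$). **Corollary.** A homology sphere of dimension $d\ge0$ is $1$-stellated if and only if it is $1$-stacked. Moreover $\Sigma_1(d)=\mathcal S_1(d)$ for every $d\ge0$, and hence $\mathcal W_1(d)=\mathcal K_1(d)$ for every $d\ge1$. -/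

import Mathlib

/-- A finite abstract simplicial complex with vertices in `V`: a finite collection of finite
subsets of `V` that is closed under taking subsets.  The empty set counts as a face; it belongs
to every complex that has any face at all. -/
@[ext]
structure FinComplex (V : Type*) where
  faces : Set (Finset V)
  finite_faces : faces.Finite
  down_closed : ∀ σ ∈ faces, ∀ τ : Finset V, τ ⊆ σ → τ ∈ faces

namespace FinComplex

variable {V : Type*}

instance : Membership (Finset V) (FinComplex V) := ⟨fun X σ => σ ∈ X.faces⟩

/-- `X` has dimension `d`: the largest faces have `d + 1` vertices. -/
def HasDim (d : ℕ) (X : FinComplex V) : Prop :=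
  (∃ σ ∈ X, σ.card = d + 1) ∧ ∀ σ ∈ X, σ.card ≤ d + 1

/-- Any two vertices are joined by a path of edges. -/
def Connected [DecidableEq V] (X : FinComplex V) : Prop :=
  (∃ v : V, ({v} : Finset V) ∈ X) ∧
    ∀ u v : V, {u} ∈ X → {v} ∈ X →
      Relation.ReflTransGen (fun a b : V => ({a, b} : Finset V) ∈ X) u v

/-- The link of `σ` in `X`: all `τ` disjoint from `σ` with `τ ∪ σ` a face of `X`. -/
def link [DecidableEq V] (X : FinComplex V) (σ : Finset V) : FinComplex V where
  faces := {τ | Disjoint τ σ ∧ τ ∪ σ ∈ X}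
  finite_faces := X.finite_faces.subset fun _ hτ =>
    X.down_closed _ hτ.2 _ Finset.subset_union_left
  down_closed := fun _ hρ _ hτ =>
    ⟨hρ.1.mono_left hτ, X.down_closed _ hρ.2 _ (Finset.union_subset_union_left hτ)⟩

/-- The boundary of an `n`-dimensional complex `X`: the pure subcomplex whose facets are the
`(n - 1)`-dimensional faces of `X` lying in exactly one `n`-dimensional face of `X`. -/
def boundary (n : ℕ) (X : FinComplex V) : FinComplex V where
  faces := {τ | ∃ ρ ∈ X, ρ.card = n ∧ (∃! σ : Finset V, σ ∈ X ∧ σ.card = n + 1 ∧ ρ ⊆ σ) ∧ τ ⊆ ρ}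
  finite_faces := X.finite_faces.subset fun τ ⟨ρ, hρ, _, _, hτ⟩ => X.down_closed ρ hρ τ hτ
  down_closed := fun _ ⟨ρ, hρ, hc, hu, hσ⟩ _ hτ => ⟨ρ, hρ, hc, hu, hτ.trans hσ⟩

section Homology

variable [LinearOrder V] (F : Type*) [Field F]

/-- The dimension of the quotient of `Z` by (its intersection with) `B`. -/
noncomputable def quotientRank {M : Type*} [AddCommGroup M] [Module F M]
    (Z B : Submodule F M) : ℕ :=
  Module.finrank F (Z ⧸ B.submoduleOf Z)

/-- The simplicial boundary operator, simplices being oriented by the order on the vertices: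
`∂ [v₀ < ⋯ < v_n] = ∑ (-1)^i [v₀, …, v̂_i, …, v_n]`; a vertex is sent to the empty simplex
(the augmentation). -/
noncomputable def chainBoundary : (Finset V →₀ F) →ₗ[F] (Finset V →₀ F) :=
  Finsupp.linearCombination F fun σ : Finset V =>
    ∑ v ∈ σ, Finsupp.single (σ.erase v) ((-1 : F) ^ (σ.filter (· < v)).card)

/-- Simplicial chains of `X` spanned by the faces with exactly `m` vertices
(the chains of dimension `m - 1`). -/
def chains (X : FinComplex V) (m : ℕ) : Submodule F (Finset V →₀ F) :=
  Finsupp.supported F F {σ | σ ∈ X ∧ σ.card = m}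

/-- The reduced cycles of dimension `m - 1`. -/
noncomputable def cycles (X : FinComplex V) (m : ℕ) : Submodule F (Finset V →₀ F) :=
  X.chains F m ⊓ LinearMap.ker (chainBoundary F)

/-- The boundaries of dimension `m - 1`. -/
noncomputable def boundaries (X : FinComplex V) (m : ℕ) : Submodule F (Finset V →₀ F) :=
  (X.chains F (m + 1)).map (chainBoundary F)

/-- The reduced Betti number over `F` in dimension `m - 1`, i.e. the dimension of the reduced
homology `H̃_{m-1}(X; F)` (cycles modulo boundaries).  All `m : ℕ` together cover all
dimensions `≥ -1`. -/
noncomputable def reducedBetti (X : FinComplex V) (m : ℕ) : ℕ :=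
  quotientRank F (X.cycles F m) (X.boundaries F m)

/-- `X` is an `F`-homology sphere of dimension `d`: it has dimension `d`, and the link of every
face `σ` (including the empty one) has the reduced `F`-homology of a sphere of dimension
`d - dim σ - 1 = d - #σ`. -/
def IsHomologySphereOver (d : ℕ) (X : FinComplex V) : Prop :=
  X.HasDim d ∧
    ∀ σ ∈ X, ∀ m : ℕ, (X.link σ).reducedBetti F m = if m + σ.card = d + 1 then 1 else 0

/-- `B` is an `F`-homology ball of dimension `d + 1`: it has dimension `d + 1`, its boundary is
an `F`-homology sphere of dimension `d`, the links of the boundary faces (in particular `B`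
itself, the link of the empty face) are `F`-acyclic, and the link of each remaining face `σ` has
the reduced `F`-homology of a sphere of dimension `d + 1 - #σ`. -/
def IsHomologyBallOver (d : ℕ) (B : FinComplex V) : Prop :=
  B.HasDim (d + 1) ∧ IsHomologySphereOver F d (B.boundary (d + 1)) ∧
    (∀ σ ∈ B.boundary (d + 1), ∀ m : ℕ, (B.link σ).reducedBetti F m = 0) ∧
    ∀ σ ∈ B, σ ∉ B.boundary (d + 1) →
      ∀ m : ℕ, (B.link σ).reducedBetti F m = if m + σ.card = d + 2 then 1 else 0

end Homology

/-- A homology `d`-sphere: an `F`-homology sphere for some field `F`.  (Betti numbers depend only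
on the characteristic of `F`, so the universe of `F` plays no role.) -/
def IsHomologySphere [LinearOrder V] (d : ℕ) (X : FinComplex V) : Prop :=
  ∃ (F : Type) (_ : Field F), IsHomologySphereOver F d X

/-- A homology ball of dimension `d + 1`: an `F`-homology ball for some field `F`. -/
def IsHomologyBall [LinearOrder V] (d : ℕ) (B : FinComplex V) : Prop :=
  ∃ (F : Type) (_ : Field F), IsHomologyBallOver F d B

/-- A homology ball `B` of dimension `d + 1` is `k`-stacked if all its faces of codimension at
least `k + 1`, i.e. of dimension at most `d - k`, lie in its boundary. -/
def IsStackedBall [LinearOrder V] (k d : ℕ) (B : FinComplex V) : Prop :=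
  IsHomologyBall d B ∧ ∀ σ ∈ B, σ.card + k ≤ d + 1 → σ ∈ B.boundary (d + 1)

/-- A homology `d`-sphere is `k`-stacked if it is the boundary of a `k`-stacked homology
ball of dimension `d + 1`. -/
def IsStackedSphere [LinearOrder V] (k d : ℕ) (S : FinComplex V) : Prop :=
  IsHomologySphere d S ∧ ∃ B : FinComplex V, IsStackedBall k d B ∧ B.boundary (d + 1) = S

/-- `X` is a standard `d`-sphere: all proper subsets of a set of `d + 2` vertices. -/
def IsStandardSphere (d : ℕ) (X : FinComplex V) : Prop :=
  ∃ s : Finset V, s.card = d + 2 ∧ ∀ σ : Finset V, σ ∈ X ↔ σ ⊂ s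

/-- `σ` is a face of the join of the full simplex on `α` with the boundary complex of the
simplex on `β` (for disjoint `α`, `β`). -/
def InSimplexJoinBoundary [DecidableEq V] (α β σ : Finset V) : Prop :=
  σ ⊆ α ∪ β ∧ ¬ β ⊆ σ

/-- `Y` is obtained from the `d`-dimensional complex `X` by the bistellar move `α ↦ β`: the
subcomplex of `X` induced on `α ⊔ β` is `ᾱ * ∂β`, of dimension `d`, and `Y` results from `X` by
replacing `ᾱ * ∂β` with `∂α * β̄`. -/
def IsBistellarMove [DecidableEq V] (d : ℕ) (X Y : FinComplex V) (α β : Finset V) : Prop :=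
  X.HasDim d ∧ α.Nonempty ∧ β.Nonempty ∧ Disjoint α β ∧ α.card + β.card = d + 2 ∧
    (∀ σ : Finset V, σ ⊆ α ∪ β → (σ ∈ X ↔ InSimplexJoinBoundary α β σ)) ∧
    ∀ σ : Finset V, σ ∈ Y ↔
      (σ ∈ X ∧ ¬ InSimplexJoinBoundary α β σ) ∨ InSimplexJoinBoundary β α σ

/-- `X` is a `k`-stellated `d`-sphere: it is obtained from a standard `d`-sphere by finitely many
bistellar moves of index `< k`, the index of `α ↦ β` being `dim β = #β - 1`. -/
inductive IsStellated [DecidableEq V] (k d : ℕ) : FinComplex V → Prop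
  | standard (X : FinComplex V) : IsStandardSphere d X → IsStellated k d X
  | move (X Y : FinComplex V) (α β : Finset V) (i : ℕ) : IsStellated k d X →
      IsBistellarMove d X Y α β → β.card = i + 1 → i < k → IsStellated k d Y

variable (V) in
/-- The class `Σ_k(d)` of `k`-stellated `d`-spheres. -/
def stellatedSpheres [DecidableEq V] (k d : ℕ) : Set (FinComplex V) :=
  {X | IsStellated k d X}

variable (V) in
/-- The class `S_k(d)` of `k`-stacked homology `d`-spheres. -/
def stackedSpheres [LinearOrder V] (k d : ℕ) : Set (FinComplex V) :=
  {X | IsStackedSphere k d X}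

variable (V) in
/-- The class `W_k(d)`, for `d ≥ 1`: connected `d`-dimensional complexes all of whose vertex
links are `k`-stellated `(d - 1)`-spheres. -/
def classW [DecidableEq V] (k d : ℕ) : Set (FinComplex V) :=
  {X | X.HasDim d ∧ X.Connected ∧ ∀ v : V, {v} ∈ X → X.link {v} ∈ stellatedSpheres V k (d - 1)}

variable (V) in
/-- The class `K_k(d)`, for `d ≥ 1`: connected `d`-dimensional complexes all of whose vertex
links are `k`-stacked homology `(d - 1)`-spheres. -/
def classK [LinearOrder V] (k d : ℕ) : Set (FinComplex V) :=
  {X | X.HasDim d ∧ X.Connected ∧ ∀ v : V, {v} ∈ X → X.link {v} ∈ stackedSpheres V k (d - 1)}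

end FinComplex

/-! Both classes consist of the boundaries of combinatorially stacked balls: complexes built from a
simplex by repeatedly gluing on, along a boundary facet `α`, a simplex whose remaining vertex `v` is
new. Their facet sets are the families in `IsStackedFamily`.

On the boundary, such a gluing is exactly a bistellar move of index 0. Conversely, a move of index 0
on the boundary of a stacked ball extends to a gluing, since for `d ≥ 1` every vertex of the ball
lies on its boundary (`exists_isStackedFamily_of_isStellated`). A stacked ball is a `1`-stacked
homology ball: by induction on the gluings, all links have the right Betti numbers
(`IsStackedFamily.reducedBetti_link`). The comparison of old and new links rests on
`reducedBetti_eq_of_toggle`, a chain-level form of cancelling faces in pairs that differ by one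
vertex.

The substantial direction is that the facets of a `1`-stacked homology ball `B` with boundary `S`
form a stacked family. The facets around a face with at most `d + 1` vertices are connected through
ridges. Moreover each interior ridge `α` separates its two facets (`not_reflTransGen_ridgeAdj`).
Indeed `∂α` lies in `S` by stackedness and bounds a chain `c` there, and `α - c` is a cycle of the
acyclic `B`, hence some `∂e`. Let `z` be a chain of facets filling a non-zero top cycle of `S`. At
interior ridges other than `α` both `∂z` and `∂e` vanish, so the ratio of the coefficients of `e`
and `z` is constant along a path avoiding `α`. If such a path joined the two facets at `α`, then
`∂e` would vanish at `α` along with `∂z`; but its coefficient there is 1.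

Given separation, a maximal stacked subfamily is everything (`isStackedFamily_of_separating`): a
facet adjacent to it across `α` brings a new vertex, for otherwise the star of that vertex would
provide a path around `α`. -/

namespace FinComplex

/-! ### Chains as finitely supported functions on faces -/

section Chains

variable {V : Type*} {F : Type*} [Field F]

lemma mem_chains {X : FinComplex V} {m : ℕ} {c : Finset V →₀ F} :
    c ∈ X.chains F m ↔ ∀ σ, c σ ≠ 0 → σ ∈ X ∧ σ.card = m := by
  simp only [chains, Finsupp.mem_supported, Set.subset_def, Finset.mem_coe, Finsupp.mem_support_iff,
    Set.mem_ofPred_eq]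

lemma single_mem_chains {X : FinComplex V} {m : ℕ} {σ : Finset V} (hσ : σ ∈ X) (hm : σ.card = m)
    (c : F) : Finsupp.single σ c ∈ X.chains F m :=
  Finsupp.single_mem_supported F c (by exact ⟨hσ, hm⟩)

lemma chains_mono {X Y : FinComplex V} (h : ∀ σ ∈ X, σ ∈ Y) (m : ℕ) :
    X.chains F m ≤ Y.chains F m :=
  Finsupp.supported_mono fun σ hσ => ⟨h σ hσ.1, hσ.2⟩

/-- A chain supported in a set of faces is mapped into any submodule that contains the images of
these faces. -/
lemma map_supported_mem {s : Set (Finset V)} {c : Finset V →₀ F} (hc : c ∈ Finsupp.supported F F s)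
    (f : (Finset V →₀ F) →ₗ[F] (Finset V →₀ F)) (P : Submodule F (Finset V →₀ F))
    (h : ∀ σ ∈ s, f (Finsupp.single σ 1) ∈ P) : f c ∈ P := by
  rw [Finsupp.supported_eq_span_single] at hc
  have : Submodule.span F ((fun i => Finsupp.single i (1 : F)) '' s) ≤ P.comap f := by
    rw [Submodule.span_le]
    rintro _ ⟨σ, hσ, rfl⟩
    exact h σ hσ
  exact this hc

lemma exists_chain_decomposition {X X' : FinComplex V} {m : ℕ} {c : Finset V →₀ F}
    (hc : c ∈ X'.chains F m) :
    ∃ x ∈ X.chains F m, ∃ q ∈ Finsupp.supported F F {σ | (σ ∈ X' ∧ σ ∉ X) ∧ σ.card = m},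
      c = x + q := by
  classical
  refine ⟨c.filter (· ∈ X), ?_, c.filter (fun σ => ¬ σ ∈ X), ?_,
    (Finsupp.filter_add_filter_not c _).symm⟩
  · rw [mem_chains]
    intro σ hσ
    rw [Finsupp.filter_apply] at hσ
    split_ifs at hσ with h
    · exact ⟨h, (mem_chains.1 hc σ hσ).2⟩
    · exact absurd rfl hσ
  · intro σ hσ
    rw [Finset.mem_coe, Finsupp.mem_support_iff, Finsupp.filter_apply] at hσ
    by_cases h : σ ∈ X
    · rw [if_neg (not_not.2 h)] at hσ
      exact absurd rfl hσ
    · rw [if_pos h] at hσ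
      exact ⟨⟨(mem_chains.1 hc σ hσ).1, h⟩, (mem_chains.1 hc σ hσ).2⟩

end Chains

/-! ### The cone contraction and invariance of Betti numbers -/

section ChainHomology

variable {V : Type*} [LinearOrder V] (F : Type*) [Field F]

/-- The sign `(-1)^i`, where `i` is the number of vertices of `σ` before `v`. -/
def vertexSign (σ : Finset V) (v : V) : F := (-1 : F) ^ (σ.filter (· < v)).card

lemma vertexSign_mul_self (σ : Finset V) (v : V) : vertexSign F σ v * vertexSign F σ v = 1 := by
  unfold vertexSign
  rw [← pow_add, ← two_mul, pow_mul]
  simp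

lemma vertexSign_ne_zero (σ : Finset V) (v : V) : vertexSign F σ v ≠ 0 :=
  left_ne_zero_of_mul_eq_one (vertexSign_mul_self F σ v)

lemma vertexSign_erase_self (σ : Finset V) (v : V) :
    vertexSign F (σ.erase v) v = vertexSign F σ v := by
  unfold vertexSign
  congr 2
  ext x
  simp only [Finset.mem_filter, Finset.mem_erase]
  exact ⟨fun h => ⟨h.1.2, h.2⟩, fun h => ⟨⟨h.2.ne, h.1⟩, h.2⟩⟩

lemma vertexSign_insert_self (σ : Finset V) (v : V) :
    vertexSign F (insert v σ) v = vertexSign F σ v := by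
  unfold vertexSign
  congr 2
  ext x
  simp only [Finset.mem_filter, Finset.mem_insert]
  exact ⟨fun h => ⟨h.1.resolve_left h.2.ne, h.2⟩, fun h => ⟨Or.inr h.1, h.2⟩⟩

lemma vertexSign_insert_of_lt {σ : Finset V} {a v : V} (ha : a ∉ σ) (h : a < v) :
    vertexSign F (insert a σ) v = -vertexSign F σ v := by
  unfold vertexSign
  rw [Finset.filter_insert, if_pos h, Finset.card_insert_of_notMem (by simp [ha]), pow_succ]
  ring

lemma vertexSign_insert_of_not_lt {σ : Finset V} {a v : V} (h : ¬ a < v) :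
    vertexSign F (insert a σ) v = vertexSign F σ v := by
  unfold vertexSign
  rw [Finset.filter_insert, if_neg h]

/-- Inserting `a` and deleting `x` in the two possible orders gives opposite signs; this is the
cancellation behind the cone identity. -/
lemma vertexSign_insert_mul {σ : Finset V} {a x : V} (ha : a ∉ σ) (hx : x ∈ σ) :
    vertexSign F σ a * vertexSign F (insert a σ) x =
      -(vertexSign F σ x * vertexSign F (σ.erase x) a) := by
  have hne : a ≠ x := fun h => ha (h ▸ hx)
  have hσ : vertexSign F σ a = vertexSign F (insert x (σ.erase x)) a := by
    rw [Finset.insert_erase hx]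
  rcases lt_or_gt_of_ne hne with h | h
  · rw [hσ, vertexSign_insert_of_lt F ha h, vertexSign_insert_of_not_lt F h.not_gt]
    ring
  · rw [hσ, vertexSign_insert_of_not_lt F h.not_gt,
      vertexSign_insert_of_lt F (Finset.notMem_erase x σ) h]
    ring

lemma chainBoundary_single (σ : Finset V) (c : F) :
    chainBoundary F (Finsupp.single σ c) =
      c • ∑ v ∈ σ, Finsupp.single (σ.erase v) (vertexSign F σ v) := by
  simp [chainBoundary, vertexSign]

/-- The cone operator with apex `a`. -/
noncomputable def coneOperator (a : V) : (Finset V →₀ F) →ₗ[F] (Finset V →₀ F) :=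
  Finsupp.linearCombination F fun σ : Finset V =>
    if a ∈ σ then 0 else Finsupp.single (insert a σ) (vertexSign F σ a)

lemma coneOperator_single_of_mem {a : V} {σ : Finset V} (h : a ∈ σ) (c : F) :
    coneOperator F a (Finsupp.single σ c) = 0 := by
  simp [coneOperator, h]

lemma coneOperator_single_of_notMem {a : V} {σ : Finset V} (h : a ∉ σ) (c : F) :
    coneOperator F a (Finsupp.single σ c) =
      c • Finsupp.single (insert a σ) (vertexSign F σ a) := by
  simp [coneOperator, h]

/-- The cone operator is a chain contraction of the complex of all chains. -/
lemma chainBoundary_coneOperator (a : V) (c : Finset V →₀ F) :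
    chainBoundary F (coneOperator F a c) + coneOperator F a (chainBoundary F c) = c := by
  suffices h : chainBoundary F ∘ₗ coneOperator F a + coneOperator F a ∘ₗ chainBoundary F =
      LinearMap.id from LinearMap.congr_fun h c
  refine Finsupp.lhom_ext' fun σ => LinearMap.ext_ring ?_
  simp only [LinearMap.comp_apply, LinearMap.add_apply, Finsupp.lsingle_apply, LinearMap.id_apply]
  by_cases ha : a ∈ σ
  · rw [coneOperator_single_of_mem F ha, map_zero, zero_add, chainBoundary_single, one_smul,
      map_sum, Finset.sum_eq_single_of_mem a ha]
    · rw [coneOperator_single_of_notMem F (Finset.notMem_erase a σ), Finset.insert_erase ha,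
        vertexSign_erase_self, Finsupp.smul_single, smul_eq_mul, vertexSign_mul_self]
    · intro x _ hxa
      exact coneOperator_single_of_mem F (Finset.mem_erase.2 ⟨hxa.symm, ha⟩) _
  · rw [coneOperator_single_of_notMem F ha, one_smul, chainBoundary_single, chainBoundary_single,
      one_smul, Finset.sum_insert ha, Finset.erase_insert ha, vertexSign_insert_self, smul_add,
      Finsupp.smul_single, smul_eq_mul, vertexSign_mul_self, add_assoc, add_eq_left, map_sum,
      Finset.smul_sum, ← Finset.sum_add_distrib]
    refine Finset.sum_eq_zero fun x hx => ?_
    have hne : a ≠ x := fun h => ha (h ▸ hx)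
    rw [coneOperator_single_of_notMem F (fun h => ha (Finset.mem_of_mem_erase h)),
      Finset.erase_insert_of_ne hne, Finsupp.smul_single, Finsupp.smul_single, smul_eq_mul,
      smul_eq_mul, vertexSign_insert_mul F ha hx, ← Finsupp.single_add]
    simp

lemma coneOperator_chainBoundary (a : V) (c : Finset V →₀ F) :
    coneOperator F a (chainBoundary F c) = c - chainBoundary F (coneOperator F a c) :=
  eq_sub_of_add_eq' (chainBoundary_coneOperator F a c)

/-- A simplex is, up to sign, a cone over a smaller one, so `∂∂ = 0` follows by induction from the
contraction identity applied to `σ` and to `∂σ`. -/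
lemma chainBoundary_single_chainBoundary (σ : Finset V) :
    chainBoundary F (chainBoundary F (Finsupp.single σ (1 : F))) = 0 := by
  induction σ using Finset.induction_on with
  | empty => simp [chainBoundary_single]
  | insert a σ ha ih =>
    have hσ : Finsupp.single (insert a σ) (1 : F) =
        vertexSign F σ a • coneOperator F a (Finsupp.single σ 1) := by
      rw [coneOperator_single_of_notMem F ha, one_smul, Finsupp.smul_single, smul_eq_mul,
        vertexSign_mul_self]
    have h1 := chainBoundary_coneOperator F a (Finsupp.single σ 1)
    have h2 := chainBoundary_coneOperator F a (chainBoundary F (Finsupp.single σ 1))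
    rw [ih, map_zero, add_zero] at h2
    rw [hσ, map_smul, map_smul, eq_sub_of_add_eq h1, map_sub, h2, sub_self, smul_zero]

lemma chainBoundary_chainBoundary (c : Finset V →₀ F) :
    chainBoundary F (chainBoundary F c) = 0 := by
  suffices h : chainBoundary F ∘ₗ chainBoundary F = (0 : (Finset V →₀ F) →ₗ[F] _) from
    LinearMap.congr_fun h c
  exact Finsupp.lhom_ext' fun σ => LinearMap.ext_ring (chainBoundary_single_chainBoundary F σ)

variable {F}

lemma chainBoundary_single_mem_chains {X : FinComplex V} {m : ℕ} {σ : Finset V}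
    (h : ∀ v ∈ σ, σ.erase v ∈ X) (hσ : σ.card = m + 1) (c : F) :
    chainBoundary F (Finsupp.single σ c) ∈ X.chains F m := by
  rw [chainBoundary_single]
  refine Submodule.smul_mem _ _ (Submodule.sum_mem _ fun v hv => single_mem_chains (h v hv) ?_ _)
  rw [Finset.card_erase_of_mem hv, hσ, Nat.add_sub_cancel]

lemma chainBoundary_mem_chains {X : FinComplex V} {m : ℕ} {c : Finset V →₀ F}
    (hc : c ∈ X.chains F (m + 1)) : chainBoundary F c ∈ X.chains F m :=
  map_supported_mem hc _ _ fun σ hσ => chainBoundary_single_mem_chains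
    (fun v _ => X.down_closed σ hσ.1 _ (Finset.erase_subset v σ)) hσ.2 1

lemma coneOperator_mem_supported {s : Set (Finset V)} {c : Finset V →₀ F}
    (hc : c ∈ Finsupp.supported F F s) (a : V) :
    coneOperator F a c ∈ Finsupp.supported F F {τ | ∃ σ ∈ s, a ∉ σ ∧ τ = insert a σ} := by
  refine map_supported_mem hc _ _ fun σ hσ => ?_
  by_cases ha : a ∈ σ
  · rw [coneOperator_single_of_mem F ha]
    exact zero_mem _
  · rw [coneOperator_single_of_notMem F ha, one_smul]
    exact Finsupp.single_mem_supported F _ ⟨σ, hσ, ha, rfl⟩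

/-- If `X' \ X` is closed under adding and removing the vertex `a`, then a chain of `X' \ X` whose
boundary lies in `X` is homologous to a chain of `X`. -/
lemma sub_chainBoundary_coneOperator_mem {X X' : FinComplex V} {a : V}
    (hadd : ∀ σ ∈ X', σ ∉ X → insert a σ ∈ X')
    (hdel : ∀ σ ∈ X, a ∉ σ → insert a σ ∈ X' → insert a σ ∈ X)
    {m k : ℕ} {q : Finset V →₀ F}
    (hq : q ∈ Finsupp.supported F F {σ | (σ ∈ X' ∧ σ ∉ X) ∧ σ.card = m})
    (hb : chainBoundary F q ∈ X.chains F k) :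
    coneOperator F a q ∈ X'.chains F (m + 1) ∧
      q - chainBoundary F (coneOperator F a q) ∈ X.chains F m := by
  have h1 : coneOperator F a q ∈ X'.chains F (m + 1) := by
    refine Finsupp.supported_mono ?_ (coneOperator_mem_supported hq a)
    rintro _ ⟨σ, hσ, ha, rfl⟩
    exact ⟨hadd σ hσ.1.1 hσ.1.2, by rw [Finset.card_insert_of_notMem ha, hσ.2]⟩
  refine ⟨h1, ?_⟩
  have h2 : q - chainBoundary F (coneOperator F a q) ∈ X'.chains F m :=
    sub_mem (Finsupp.supported_mono
      (fun σ (hσ : (σ ∈ X' ∧ σ ∉ X) ∧ σ.card = m) => show σ ∈ X' ∧ σ.card = m from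
        ⟨hσ.1.1, hσ.2⟩) hq) (chainBoundary_mem_chains h1)
  have h3 := coneOperator_mem_supported hb a
  -- The difference is also the cone over `∂q`: each of its faces is a face of `X` with `a` added,
  -- and since it lies in `X'`, `hdel` puts it in `X`.
  rw [coneOperator_chainBoundary] at h3
  rw [mem_chains]
  intro τ hτ
  obtain ⟨hτX, hτm⟩ := mem_chains.1 h2 τ hτ
  obtain ⟨σ, hσ, ha, rfl⟩ := (Finsupp.mem_supported F _).1 h3
    (Finsupp.mem_support_iff.2 hτ)
  exact ⟨hdel σ hσ.1 ha hτX, hτm⟩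

/-- If `X` is a subcomplex of `X'` and `X' \ X` is closed under adding and removing the vertex `a`,
then `X` and `X'` have the same reduced Betti numbers. -/
theorem reducedBetti_eq_of_toggle {X X' : FinComplex V} {a : V} (hXX' : ∀ σ ∈ X, σ ∈ X')
    (hadd : ∀ σ ∈ X', σ ∉ X → insert a σ ∈ X')
    (hdel : ∀ σ ∈ X, a ∉ σ → insert a σ ∈ X' → insert a σ ∈ X) (m : ℕ) :
    X.reducedBetti F m = X'.reducedBetti F m := by
  have hZ : X.cycles F m ≤ X'.cycles F m := inf_le_inf_right _ (chains_mono hXX' m)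
  have hB : (X.boundaries F m).submoduleOf (X.cycles F m) ≤
      ((X'.boundaries F m).submoduleOf (X'.cycles F m)).comap (Submodule.inclusion hZ) := by
    intro z hz
    exact Submodule.map_mono (chains_mono hXX' (m + 1)) hz
  unfold reducedBetti quotientRank
  refine LinearEquiv.finrank_eq (LinearEquiv.ofBijective
    (Submodule.mapQ _ _ (Submodule.inclusion hZ) hB) ⟨?_, ?_⟩)
  · rw [← LinearMap.ker_eq_bot, LinearMap.ker_eq_bot']
    intro z
    obtain ⟨z, rfl⟩ := Submodule.Quotient.mk_surjective _ z
    intro h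
    rw [Submodule.mapQ_apply, Submodule.Quotient.mk_eq_zero] at h
    rw [Submodule.Quotient.mk_eq_zero]
    obtain ⟨c, hc, hcz⟩ := h
    -- Injectivity: the part `q` of the filling outside `X` has its boundary in `X`, so it can be
    -- pushed into `X` without changing that boundary.
    obtain ⟨x, hx, q, hq, rfl⟩ := exists_chain_decomposition (X := X) hc
    have hqb : chainBoundary F q ∈ X.chains F m := by
      have : chainBoundary F q = z.1 - chainBoundary F x := by
        rw [eq_sub_iff_add_eq', ← map_add]
        exact hcz
      rw [this]
      exact sub_mem z.2.1 (chainBoundary_mem_chains hx)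
    refine ⟨x + (q - chainBoundary F (coneOperator F a q)),
      add_mem hx (sub_chainBoundary_coneOperator_mem hadd hdel hq hqb).2, ?_⟩
    rw [map_add, map_sub, chainBoundary_chainBoundary, sub_zero, ← map_add]
    exact hcz
  · intro z
    obtain ⟨z, rfl⟩ := Submodule.Quotient.mk_surjective _ z
    obtain ⟨x, hx, q, hq, hz⟩ := exists_chain_decomposition (X := X) z.2.1
    have hbz : chainBoundary F x + chainBoundary F q = 0 := by
      rw [← map_add, ← hz]
      exact z.2.2
    -- For `m = 0` the subtraction truncates; this is harmless, as the empty simplex has boundary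
    -- zero.
    have hqb : chainBoundary F q ∈ X.chains F (m - 1) := by
      rw [eq_neg_of_add_eq_zero_right hbz]
      refine neg_mem (map_supported_mem hx _ _ fun σ hσ => ?_)
      rcases Nat.eq_zero_or_pos m with rfl | hm
      · rw [Finset.card_eq_zero.1 hσ.2, chainBoundary_single]
        simp
      · exact chainBoundary_single_mem_chains
          (fun v _ => X.down_closed σ hσ.1 _ (Finset.erase_subset v σ))
          (by rw [hσ.2, Nat.sub_add_cancel hm]) 1
    obtain ⟨h1, h2⟩ := sub_chainBoundary_coneOperator_mem hadd hdel hq hqb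
    refine ⟨Submodule.Quotient.mk ⟨x + (q - chainBoundary F (coneOperator F a q)),
      add_mem hx h2, ?_⟩, ?_⟩
    · rw [SetLike.mem_coe, LinearMap.mem_ker, map_add, map_sub, chainBoundary_chainBoundary,
        sub_zero, hbz]
    · rw [Submodule.mapQ_apply, eq_comm, Submodule.Quotient.eq]
      refine ⟨_, h1, ?_⟩
      change _ = z.1 - (x + (q - chainBoundary F (coneOperator F a q)))
      rw [hz]
      abel

lemma reducedBetti_eq_zero {X : FinComplex V} {m : ℕ} (h : X.cycles F m ≤ X.boundaries F m) :
    X.reducedBetti F m = 0 := by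
  unfold reducedBetti quotientRank
  rw [Submodule.submoduleOf_eq_top.2 h]
  exact Module.finrank_zero_of_subsingleton

/-- `finrank` is also zero on infinite-dimensional spaces, so finiteness is what allows a vanishing
Betti number to be read as vanishing homology. -/
instance finite_chains (X : FinComplex V) (m : ℕ) : Module.Finite F (X.chains F m) := by
  have : Finite {σ | σ ∈ X ∧ σ.card = m} := (X.finite_faces.subset fun _ h => h.1).to_subtype
  exact Module.Finite.equiv
    (Finsupp.supportedEquivFinsupp (M := F) (R := F) {σ | σ ∈ X ∧ σ.card = m}).symm

instance finite_cycles (X : FinComplex V) (m : ℕ) : Module.Finite F (X.cycles F m) :=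
  Submodule.finiteDimensional_of_le (S₂ := X.chains F m) inf_le_left

lemma cycles_le_boundaries {X : FinComplex V} {m : ℕ} (h : X.reducedBetti F m = 0) :
    X.cycles F m ≤ X.boundaries F m := by
  unfold reducedBetti quotientRank at h
  exact Submodule.submoduleOf_eq_top.1
    (Submodule.Quotient.subsingleton_iff.1 (Module.finrank_zero_iff.1 h))

lemma exists_cycle_ne_zero {X : FinComplex V} {m : ℕ} (h : X.reducedBetti F m ≠ 0) :
    ∃ z ∈ X.cycles F m, z ≠ 0 := by
  by_contra! hz
  exact h (reducedBetti_eq_zero fun z hzc => hz z hzc ▸ zero_mem _)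

end ChainHomology

/-! ### Homology of simplices and their boundaries; connectedness -/

section SimplexHomology

/-- The full simplex with vertex set `s`. -/
def fullSimplex {V : Type*} (s : Finset V) : FinComplex V where
  faces := {σ | σ ⊆ s}
  finite_faces := by
    refine s.powerset.finite_toSet.subset fun σ hσ => ?_
    exact Finset.mem_coe.2 (Finset.mem_powerset.2 hσ)
  down_closed := fun _ hσ _ hτ => Finset.Subset.trans hτ hσ

/-- The boundary complex of the simplex with vertex set `s`. -/
def simplexBoundary {V : Type*} (s : Finset V) : FinComplex V where
  faces := {σ | σ ⊂ s}
  finite_faces := by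
    refine s.powerset.finite_toSet.subset fun σ hσ => ?_
    exact Finset.mem_coe.2 (Finset.mem_powerset.2 (show σ ⊂ s from hσ).subset)
  down_closed := fun _ hσ _ hτ => lt_of_le_of_lt hτ hσ

lemma mem_fullSimplex {V : Type*} {s σ : Finset V} : σ ∈ fullSimplex s ↔ σ ⊆ s := Iff.rfl

lemma mem_simplexBoundary {V : Type*} {s σ : Finset V} : σ ∈ simplexBoundary s ↔ σ ⊂ s := Iff.rfl

lemma ext_mem {V : Type*} {X Y : FinComplex V} (h : ∀ σ, σ ∈ X ↔ σ ∈ Y) : X = Y :=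
  FinComplex.ext (Set.ext h)

variable {V : Type*} [LinearOrder V] {F : Type*} [Field F]

lemma coneOperator_mem_chains {X Y : FinComplex V} {a : V} {m : ℕ} {c : Finset V →₀ F}
    (h : ∀ σ ∈ X, σ.card = m → a ∉ σ → insert a σ ∈ Y) (hc : c ∈ X.chains F m) :
    coneOperator F a c ∈ Y.chains F (m + 1) := by
  refine Finsupp.supported_mono ?_ (coneOperator_mem_supported hc a)
  rintro _ ⟨σ, hσ, ha, rfl⟩
  exact ⟨h σ hσ.1 hσ.2 ha, by rw [Finset.card_insert_of_notMem ha, hσ.2]⟩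

lemma chainBoundary_coneOperator_of_cycle {X : FinComplex V} {m : ℕ} {z : Finset V →₀ F}
    (hz : z ∈ X.cycles F m) (a : V) : chainBoundary F (coneOperator F a z) = z := by
  have h := chainBoundary_coneOperator F a z
  rwa [LinearMap.mem_ker.1 hz.2, map_zero, add_zero] at h

/-- A cone is acyclic. -/
lemma reducedBetti_eq_zero_of_cone {X : FinComplex V} (a : V) (h : ∀ σ ∈ X, insert a σ ∈ X)
    (m : ℕ) : X.reducedBetti F m = 0 :=
  reducedBetti_eq_zero fun z hz => ⟨coneOperator F a z,
    coneOperator_mem_chains (fun σ hσ _ _ => h σ hσ) hz.1, chainBoundary_coneOperator_of_cycle hz a⟩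

lemma reducedBetti_fullSimplex {s : Finset V} (hs : s.Nonempty) (m : ℕ) :
    (fullSimplex s).reducedBetti F m = 0 := by
  obtain ⟨a, ha⟩ := hs
  exact reducedBetti_eq_zero_of_cone a (fun σ hσ => Finset.insert_subset ha hσ) m

lemma boundaries_eq_bot {X : FinComplex V} {m : ℕ} (h : ∀ σ ∈ X, σ.card ≤ m) :
    X.boundaries F m = ⊥ := by
  rw [eq_bot_iff]
  rintro _ ⟨c, hc, rfl⟩
  have : c = 0 := by
    ext σ
    by_contra hσ
    obtain ⟨h1, h2⟩ := mem_chains.1 hc σ hσ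
    have := h σ h1
    omega
  rw [this, map_zero]
  exact zero_mem _

lemma chainBoundary_single_apply_erase {σ : Finset V} {v : V} (hv : v ∈ σ) (c : F) :
    chainBoundary F (Finsupp.single σ c) (σ.erase v) = c * vertexSign F σ v := by
  rw [chainBoundary_single, Finsupp.smul_apply, Finsupp.finsetSum_apply,
    Finset.sum_eq_single_of_mem v hv, Finsupp.single_eq_same, smul_eq_mul]
  intro x hx hxv
  refine Finsupp.single_eq_of_ne fun h => hxv ?_
  exact (Finset.erase_injOn σ hv hx h).symm

lemma chainBoundary_single_ne_zero {σ : Finset V} (hσ : σ.Nonempty) :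
    chainBoundary F (Finsupp.single σ (1 : F)) ≠ 0 := by
  obtain ⟨v, hv⟩ := hσ
  intro h
  have := chainBoundary_single_apply_erase hv (1 : F)
  rw [h, one_mul, Finsupp.zero_apply] at this
  exact vertexSign_ne_zero F σ v this.symm

/-- Every cycle is the boundary of its cone from a vertex of `s`. The cone stays in the boundary
complex except in top degree, where it is a multiple of `s` itself, so the cycles are the multiples
of `∂s`. -/
lemma reducedBetti_simplexBoundary {s : Finset V} (hs : s.Nonempty) (m : ℕ) :
    (simplexBoundary s).reducedBetti F m = if m + 1 = s.card then 1 else 0 := by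
  obtain ⟨a, ha⟩ := id hs
  split_ifs with hm
  · have hB : (simplexBoundary s).boundaries F m = ⊥ := boundaries_eq_bot fun σ hσ => by
      have := Finset.card_lt_card (mem_simplexBoundary.1 hσ)
      omega
    have hw : chainBoundary F (Finsupp.single s (1 : F)) ∈ (simplexBoundary s).cycles F m :=
      ⟨chainBoundary_single_mem_chains (fun v hv => Finset.erase_ssubset hv) hm.symm 1,
        chainBoundary_chainBoundary F _⟩
    unfold reducedBetti quotientRank
    rw [hB]
    refine (finrank_eq_one_iff_of_nonzero' (Submodule.Quotient.mk ⟨_, hw⟩) ?_).2 ?_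
    · rw [Ne, Submodule.Quotient.mk_eq_zero]
      exact chainBoundary_single_ne_zero hs
    · intro z
      obtain ⟨z, rfl⟩ := Submodule.Quotient.mk_surjective _ z
      refine ⟨coneOperator F a z.1 s, ?_⟩
      rw [← Submodule.Quotient.mk_smul]
      congr 1
      refine Subtype.ext ?_
      change coneOperator F a z.1 s • chainBoundary F (Finsupp.single s 1) = z.1
      rw [← map_smul, Finsupp.smul_single, smul_eq_mul, mul_one]
      have hc : coneOperator F a z.1 ∈ (fullSimplex s).chains F (m + 1) :=
        coneOperator_mem_chains (fun σ hσ _ _ => Finset.insert_subset ha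
          (mem_simplexBoundary.1 hσ).subset) z.2.1
      have : Finsupp.single s (coneOperator F a z.1 s) = coneOperator F a z.1 := by
        ext σ
        by_cases hσ : σ = s
        · rw [hσ, Finsupp.single_eq_same]
        · rw [Finsupp.single_eq_of_ne hσ]
          by_contra h
          obtain ⟨h1, h2⟩ := mem_chains.1 hc σ (Ne.symm h)
          exact hσ (Finset.eq_of_subset_of_card_le h1 (by omega))
      rw [this, chainBoundary_coneOperator_of_cycle z.2 a]
  · refine reducedBetti_eq_zero fun z hz => ⟨coneOperator F a z, coneOperator_mem_chains
      (fun σ hσ hσm haσ => ?_) hz.1, chainBoundary_coneOperator_of_cycle hz a⟩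
    refine Finset.ssubset_iff_subset_ne.2
      ⟨Finset.insert_subset ha (mem_simplexBoundary.1 hσ).subset, fun h => hm ?_⟩
    rw [← h, Finset.card_insert_of_notMem haσ, hσm]

/-- A complex without reduced homology in dimension `0` is connected. -/
lemma reflTransGen_edge_of_reducedBetti_one {X : FinComplex V} (h : X.reducedBetti F 1 = 0)
    {u v : V} (hu : {u} ∈ X) (hv : {v} ∈ X) :
    Relation.ReflTransGen (fun a b : V => ({a, b} : Finset V) ∈ X) u v := by
  classical
  set R := Relation.ReflTransGen (fun a b : V => ({a, b} : Finset V) ∈ X) u with hR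
  by_contra huv
  -- `φ` sums the coefficients over the vertices reachable from `u`. It kills boundaries of edges,
  -- yet takes the value 1 on `[u] - [v]` if `v` is unreachable.
  let φ : (Finset V →₀ F) →ₗ[F] F :=
    Finsupp.linearCombination F fun σ => if ∃ x, σ = {x} ∧ R x then 1 else 0
  have hφ : ∀ x, φ (Finsupp.single {x} 1) = if R x then 1 else 0 := by
    intro x
    simp [φ]
  have hcyc : Finsupp.single {u} (1 : F) - Finsupp.single {v} 1 ∈ X.cycles F 1 := by
    refine ⟨sub_mem (single_mem_chains hu (Finset.card_singleton u) 1)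
      (single_mem_chains hv (Finset.card_singleton v) 1), ?_⟩
    rw [SetLike.mem_coe, LinearMap.mem_ker, map_sub, chainBoundary_single, chainBoundary_single]
    simp [vertexSign, Finset.filter_singleton]
  obtain ⟨c, hc, hcb⟩ := cycles_le_boundaries h hcyc
  have hker : φ (chainBoundary F c) = 0 := by
    have hle : X.chains F (1 + 1) ≤ LinearMap.ker (φ ∘ₗ chainBoundary F) := by
      unfold chains
      rw [Finsupp.supported_eq_span_single, Submodule.span_le]
      rintro _ ⟨σ, ⟨hσ, hσc⟩, rfl⟩
      obtain ⟨x, y, hxy, rfl⟩ := Finset.card_eq_two.1 hσc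
      have hiff : R x ↔ R y :=
        ⟨fun h => h.tail hσ, fun h => h.tail (by rwa [Finset.pair_comm])⟩
      have hx : ({x, y} : Finset V).erase x = {y} := by
        rw [Finset.erase_insert (by simpa using hxy)]
      have hy : ({x, y} : Finset V).erase y = {x} := by
        rw [Finset.pair_comm, Finset.erase_insert (by simpa using hxy.symm)]
      have hs : vertexSign F {x, y} x = -vertexSign F {x, y} y := by
        rcases lt_or_gt_of_ne hxy with h | h
        · simp [vertexSign, Finset.filter_insert, Finset.filter_singleton, h, h.not_gt]
        · simp [vertexSign, Finset.filter_insert, Finset.filter_singleton, h, h.not_gt]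
      have hsm : ∀ z (t : F), φ (Finsupp.single {z} t) = t * if R z then 1 else 0 := by
        intro z t
        rw [← hφ, ← smul_eq_mul, ← map_smul, Finsupp.smul_single, smul_eq_mul, mul_one]
      rw [SetLike.mem_coe, LinearMap.mem_ker, LinearMap.comp_apply, chainBoundary_single, one_smul,
        Finset.sum_pair hxy, hx, hy, map_add, hsm, hsm, hs]
      simp only [hiff]
      ring
    exact hle hc
  rw [hcb, map_sub, hφ, hφ, if_pos Relation.ReflTransGen.refl, if_neg huv, sub_zero] at hker
  exact one_ne_zero hker

end SimplexHomology

/-! ### Links under gluing a simplex and subdividing a facet -/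

section Links

variable {V : Type*} [LinearOrder V]

lemma mem_link {X : FinComplex V} {σ τ : Finset V} :
    τ ∈ X.link σ ↔ Disjoint τ σ ∧ τ ∪ σ ∈ X := Iff.rfl

lemma link_congr {X Y : FinComplex V} {σ : Finset V} (h : ∀ τ, σ ⊆ τ → (τ ∈ X ↔ τ ∈ Y)) :
    X.link σ = Y.link σ :=
  ext_mem fun _ => and_congr_right fun _ => h _ Finset.subset_union_right

lemma link_fullSimplex {s σ : Finset V} (hσ : σ ⊆ s) :
    (fullSimplex s).link σ = fullSimplex (s \ σ) := by
  refine ext_mem fun τ => ?_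
  rw [mem_link, mem_fullSimplex, mem_fullSimplex, Finset.subset_sdiff]
  exact ⟨fun h => ⟨Finset.union_subset_left h.2, h.1⟩, fun h => ⟨h.2, Finset.union_subset h.1 hσ⟩⟩

lemma link_simplexBoundary {s σ : Finset V} (hσ : σ ⊆ s) :
    (simplexBoundary s).link σ = simplexBoundary (s \ σ) := by
  refine ext_mem fun τ => ?_
  rw [mem_link, mem_simplexBoundary, mem_simplexBoundary, Finset.ssubset_iff_subset_ne,
    Finset.ssubset_iff_subset_ne, Finset.subset_sdiff]
  constructor
  · rintro ⟨h1, h2, h3⟩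
    refine ⟨⟨Finset.union_subset_left h2, h1⟩, fun h => h3 ?_⟩
    rw [h, Finset.sdiff_union_of_subset hσ]
  · rintro ⟨⟨h1, h2⟩, h3⟩
    refine ⟨h2, Finset.union_subset h1 hσ, fun h => h3 ?_⟩
    rw [← h, Finset.union_sdiff_cancel_right h2]

lemma reducedBetti_link_simplexBoundary (F : Type*) [Field F] {s σ : Finset V} (hσ : σ ⊂ s)
    (m : ℕ) : ((simplexBoundary s).link σ).reducedBetti F m =
      if m + σ.card + 1 = s.card then 1 else 0 := by
  rw [link_simplexBoundary hσ.subset,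
    reducedBetti_simplexBoundary (Finset.sdiff_nonempty.2 (not_subset_of_ssubset hσ)),
    Finset.card_sdiff_of_subset hσ.subset]
  have := Finset.card_lt_card hσ
  congr 1
  apply propext
  omega

lemma reducedBetti_link_fullSimplex (F : Type*) [Field F] {s σ : Finset V} (hσ : σ ⊂ s)
    (m : ℕ) : ((fullSimplex s).link σ).reducedBetti F m = 0 := by
  rw [link_fullSimplex hσ.subset,
    reducedBetti_fullSimplex (Finset.sdiff_nonempty.2 (not_subset_of_ssubset hσ))]

lemma reducedBetti_link_fullSimplex_self (F : Type*) [Field F] {s : Finset V} (hs : s.Nonempty)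
    (m : ℕ) : ((fullSimplex s).link s).reducedBetti F m = if m = 0 then 1 else 0 := by
  obtain ⟨x, -⟩ := hs
  -- The link is the complex `{∅}`, the `(-1)`-sphere, seen as the boundary of a one-point simplex.
  have : fullSimplex (s \ s) = simplexBoundary {x} := by
    refine ext_mem fun τ => ?_
    rw [mem_fullSimplex, mem_simplexBoundary, Finset.sdiff_self, Finset.subset_empty,
      Finset.ssubset_singleton_iff]
  rw [link_fullSimplex subset_rfl, this, reducedBetti_simplexBoundary (Finset.singleton_nonempty x)]
  simp

/-- Adding a cone over a face does not change the homology of the links of its proper faces. -/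
lemma reducedBetti_link_attach (F : Type*) [Field F] {X X' : FinComplex V} {α σ : Finset V} {v : V}
    (hα : α ∈ X) (hv : ∀ τ ∈ X, v ∉ τ) (hX' : ∀ τ, τ ∈ X' ↔ τ ⊆ insert v α ∨ τ ∈ X)
    (hσ : σ ⊂ α) (m : ℕ) :
    (X.link σ).reducedBetti F m = (X'.link σ).reducedBetti F m := by
  obtain ⟨a, haα, haσ⟩ := Finset.exists_of_ssubset hσ
  -- The added faces all contain `v`; as `a` is in `α` but not in `σ`, adding or removing it pairs
  -- them up.
  refine reducedBetti_eq_of_toggle (a := a) ?_ ?_ ?_ m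
  · exact fun τ hτ => ⟨hτ.1, (hX' _).2 (Or.inr hτ.2)⟩
  · intro τ hτ hτX
    refine ⟨Finset.disjoint_insert_left.2 ⟨haσ, hτ.1⟩, (hX' _).2 (Or.inl ?_)⟩
    rw [Finset.insert_union]
    exact Finset.insert_subset (Finset.mem_insert_of_mem haα)
      (((hX' _).1 hτ.2).resolve_right fun h => hτX ⟨hτ.1, h⟩)
  · intro τ hτ _ hτX'
    refine ⟨hτX'.1, ((hX' _).1 hτX'.2).elim (fun h => ?_) id⟩
    refine X.down_closed α hα _ fun x hx => (Finset.mem_insert.1 (h hx)).resolve_left ?_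
    rintro rfl
    rw [Finset.insert_union, Finset.mem_insert] at hx
    rcases hx with rfl | hx
    · exact hv α hα haα
    · exact hv _ hτ.2 hx

/-- Subdividing a facet by a new vertex does not change the homology of the links of its proper
faces. -/
lemma reducedBetti_link_subdivide (F : Type*) [Field F] {X Y : FinComplex V} {α σ : Finset V}
    {v : V} (hα : α ∈ X) (hmax : ∀ τ ∈ X, α ⊆ τ → τ ⊆ α) (hv : ∀ τ ∈ X, v ∉ τ)
    (hY : ∀ τ, τ ∈ Y ↔ (τ ∈ X ∧ ¬ τ ⊆ α) ∨ (τ ⊆ insert v α ∧ ¬ α ⊆ τ))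
    (hσ : σ ⊂ α) (m : ℕ) :
    (Y.link σ).reducedBetti F m = (X.link σ).reducedBetti F m := by
  -- `X'` contains both complexes. Its faces outside `X` pair up through a vertex of `α` outside
  -- `σ`; its faces outside `Y` are those between `α` and `insert v α`, and pair up through `v`.
  let X' : FinComplex V :=
    { faces := {τ | τ ⊆ insert v α ∨ τ ∈ X}
      finite_faces := (fullSimplex (insert v α)).finite_faces.union X.finite_faces
      down_closed := fun τ hτ ρ hρ => hτ.elim (fun h => Or.inl (hρ.trans h))
        fun h => Or.inr (X.down_closed τ h ρ hρ) }
  have hvσ : v ∉ σ := fun h => hv α hα (hσ.subset h)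
  rw [reducedBetti_link_attach F (X' := X') hα hv (fun τ => Iff.rfl) hσ]
  refine reducedBetti_eq_of_toggle (a := v) ?_ ?_ ?_ m
  · exact fun τ hτ => ⟨hτ.1, ((hY _).1 hτ.2).elim (fun h => Or.inr h.1) fun h => Or.inl h.1⟩
  · intro τ hτ hτY
    refine ⟨Finset.disjoint_insert_left.2 ⟨hvσ, hτ.1⟩, Or.inl ?_⟩
    rw [Finset.insert_union]
    refine Finset.insert_subset (Finset.mem_insert_self v α) (hτ.2.elim id fun h => ?_)
    by_contra hn
    exact hτY ⟨hτ.1, (hY _).2 (Or.inl ⟨h, fun h' => hn (h'.trans (Finset.subset_insert v α))⟩)⟩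
  · intro τ hτ hvτ hτX'
    refine ⟨hτX'.1, (hY _).2 (Or.inr ⟨hτX'.2.resolve_right fun h => hv _ h (by simp), fun h => ?_⟩)⟩
    have hατ : α ⊆ τ ∪ σ := by
      rw [Finset.insert_union] at h
      exact (Finset.subset_insert_iff_of_notMem (hv α hα)).1 h
    rcases (hY _).1 hτ.2 with h' | h'
    · exact h'.2 (hmax _ h'.1 hατ)
    · exact h'.2 hατ

end Links

/-! ### Stacked families and `1`-stellated spheres -/

section StackedFamily

variable {V : Type*}

/-- The complex whose faces are the subsets of the members of `𝓕`. -/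
def generated (𝓕 : Finset (Finset V)) : FinComplex V where
  faces := {σ | ∃ G ∈ 𝓕, σ ⊆ G}
  finite_faces := by
    have : {σ : Finset V | ∃ G ∈ 𝓕, σ ⊆ G} = ⋃ G ∈ 𝓕, (fullSimplex G).faces := by
      ext σ
      simp [fullSimplex]
    rw [this]
    exact Set.Finite.biUnion 𝓕.finite_toSet fun G _ => (fullSimplex G).finite_faces
  down_closed := fun _ ⟨G, hG, h⟩ _ hτ => ⟨G, hG, hτ.trans h⟩

lemma mem_generated {𝓕 : Finset (Finset V)} {σ : Finset V} :
    σ ∈ generated 𝓕 ↔ ∃ G ∈ 𝓕, σ ⊆ G := Iff.rfl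

/-- The sets of `d + 2` vertices that form the facets of a stacked ball of dimension `d + 1`: one
starts with a simplex and repeatedly attaches, along a boundary facet `α`, a simplex with one new
vertex `v`. -/
inductive IsStackedFamily [DecidableEq V] (d : ℕ) : Finset (Finset V) → Prop
  | single (s : Finset V) : s.card = d + 2 → IsStackedFamily d {s}
  | attach (𝓕 : Finset (Finset V)) (α : Finset V) (v : V) : IsStackedFamily d 𝓕 →
      α.card = d + 1 → (∃! G, G ∈ 𝓕 ∧ α ⊆ G) → (∀ G ∈ 𝓕, v ∉ G) →
      IsStackedFamily d (insert (insert v α) 𝓕)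

variable {d : ℕ} {𝓕 : Finset (Finset V)}

lemma mem_boundary_generated (h : ∀ G ∈ 𝓕, G.card = d + 2) {τ : Finset V} :
    τ ∈ (generated 𝓕).boundary (d + 1) ↔
      ∃ ρ : Finset V, ρ.card = d + 1 ∧ (∃! G, G ∈ 𝓕 ∧ ρ ⊆ G) ∧ τ ⊆ ρ := by
  have key : ∀ ρ σ : Finset V,
      (σ ∈ generated 𝓕 ∧ σ.card = d + 1 + 1 ∧ ρ ⊆ σ) ↔ (σ ∈ 𝓕 ∧ ρ ⊆ σ) := by
    intro ρ σ
    constructor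
    · rintro ⟨⟨G, hG, hσ⟩, hc, hρ⟩
      have : σ = G := Finset.eq_of_subset_of_card_le hσ (by rw [h G hG, hc])
      exact ⟨this ▸ hG, hρ⟩
    · rintro ⟨hσ, hρ⟩
      exact ⟨⟨σ, hσ, subset_rfl⟩, h σ hσ, hρ⟩
  constructor
  · rintro ⟨ρ, _, hc, hu, hτ⟩
    simp only [key] at hu
    exact ⟨ρ, hc, hu, hτ⟩
  · rintro ⟨ρ, hc, hu, hτ⟩
    refine ⟨ρ, ?_, hc, ?_, hτ⟩
    · obtain ⟨G, hG, -⟩ := hu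
      exact ⟨G, hG⟩
    · simp only [key]
      exact hu

lemma generated_singleton (s : Finset V) : generated {s} = fullSimplex s :=
  ext_mem fun σ => by simp [mem_generated, mem_fullSimplex]

lemma mem_generated_of_mem_boundary {B : FinComplex V} {n : ℕ} {σ : Finset V}
    (h : σ ∈ B.boundary n) : σ ∈ B := by
  obtain ⟨ρ, hρ, -, -, hσ⟩ := h
  exact B.down_closed ρ hρ σ hσ

lemma card_le_of_mem_boundary {B : FinComplex V} {n : ℕ} {σ : Finset V}
    (h : σ ∈ B.boundary n) : σ.card ≤ n := by
  obtain ⟨ρ, -, hc, -, hσ⟩ := h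
  exact hc ▸ Finset.card_le_card hσ

lemma mem_boundary_of_existsUnique (h : ∀ G ∈ 𝓕, G.card = d + 2) {α : Finset V}
    (hα : α.card = d + 1) (hu : ∃! G, G ∈ 𝓕 ∧ α ⊆ G) : α ∈ (generated 𝓕).boundary (d + 1) :=
  (mem_boundary_generated h).2 ⟨α, hα, hu, subset_rfl⟩

variable [LinearOrder V]

lemma IsStackedFamily.card_eq (h : IsStackedFamily d 𝓕) : ∀ G ∈ 𝓕, G.card = d + 2 := by
  induction h with
  | single s hs =>
    intro G hG
    rw [Finset.mem_singleton.1 hG, hs]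
  | attach 𝓕 α v h hα hu hv ih =>
    intro G hG
    rcases Finset.mem_insert.1 hG with rfl | hG
    · obtain ⟨G, hG, -⟩ := hu
      rw [Finset.card_insert_of_notMem (fun h => hv G hG.1 (hG.2 h)), hα]
    · exact ih G hG

lemma boundary_generated_singleton {s : Finset V} (hs : s.card = d + 2) :
    (generated {s}).boundary (d + 1) = simplexBoundary s := by
  refine ext_mem fun τ => ?_
  rw [mem_boundary_generated (by simpa using hs), mem_simplexBoundary]
  constructor
  · rintro ⟨ρ, hc, ⟨G, ⟨hG, hρ⟩, -⟩, hτ⟩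
    rw [Finset.mem_singleton.1 hG] at hρ
    refine lt_of_le_of_lt hτ (Finset.ssubset_iff_subset_ne.2 ⟨hρ, ?_⟩)
    rintro rfl
    omega
  · intro hτ
    obtain ⟨a, ha, haτ⟩ := Finset.exists_of_ssubset hτ
    refine ⟨s.erase a, by rw [Finset.card_erase_of_mem ha, hs]; rfl, ⟨s, ?_, ?_⟩,
      Finset.subset_erase.2 ⟨hτ.subset, haτ⟩⟩
    · exact ⟨Finset.mem_singleton_self s, Finset.erase_subset a s⟩
    · exact fun G hG => Finset.mem_singleton.1 hG.1

lemma mem_generated_insert {s σ : Finset V} :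
    σ ∈ generated (insert s 𝓕) ↔ σ ⊆ s ∨ σ ∈ generated 𝓕 := by
  simp [mem_generated]

/-- The ridge `α` now lies in two members and leaves the boundary. The other ridges of the new
simplex contain `v`, hence lie in no old member, and enter it. All remaining ridges keep their
status. -/
lemma mem_boundary_generated_attach (h : ∀ G ∈ 𝓕, G.card = d + 2) {α : Finset V} {v : V}
    (hα : α.card = d + 1) (hu : ∃! G, G ∈ 𝓕 ∧ α ⊆ G) (hv : ∀ G ∈ 𝓕, v ∉ G) {σ : Finset V} :
    σ ∈ (generated (insert (insert v α) 𝓕)).boundary (d + 1) ↔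
      (σ ∈ (generated 𝓕).boundary (d + 1) ∧ ¬ σ ⊆ α) ∨ (σ ⊆ insert v α ∧ ¬ α ⊆ σ) := by
  obtain ⟨G₀, ⟨hG₀, hαG₀⟩, hG₀u⟩ := id hu
  have hvα : v ∉ α := fun h => hv G₀ hG₀ (hαG₀ h)
  have hcard : (insert v α).card = d + 2 := by rw [Finset.card_insert_of_notMem hvα, hα]
  have h' : ∀ G ∈ insert (insert v α) 𝓕, G.card = d + 2 := by
    intro G hG
    rcases Finset.mem_insert.1 hG with rfl | hG
    · exact hcard
    · exact h G hG
  rw [mem_boundary_generated h', mem_boundary_generated h]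
  constructor
  · rintro ⟨ρ, hc, ⟨G, ⟨hG, hρG⟩, hGu⟩, hσ⟩
    by_cases hvρ : v ∈ ρ
    · right
      have hGe : G = insert v α := by
        rcases Finset.mem_insert.1 hG with rfl | hG
        · rfl
        · exact absurd (hρG hvρ) (hv G hG)
      refine ⟨hσ.trans (hGe ▸ hρG), fun hασ => hvα ?_⟩
      have : α = ρ := Finset.eq_of_subset_of_card_le (hασ.trans hσ) (by omega)
      rwa [this]
    · have hρα : ρ ≠ α := by
        rintro rfl
        have h1 := hGu G₀ ⟨Finset.mem_insert_of_mem hG₀, hαG₀⟩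
        have h2 := hGu (insert v ρ) ⟨Finset.mem_insert_self _ _, Finset.subset_insert v ρ⟩
        exact hv G₀ hG₀ (h1.trans h2.symm ▸ Finset.mem_insert_self v ρ)
      have hρnα : ¬ ρ ⊆ insert v α := by
        intro hs
        exact hρα (Finset.eq_of_subset_of_card_le
          ((Finset.subset_insert_iff_of_notMem hvρ).1 hs) (by omega))
      by_cases hσα : σ ⊆ α
      · right
        refine ⟨hσα.trans (Finset.subset_insert v α), fun hασ => hρα ?_⟩
        exact (Finset.eq_of_subset_of_card_le (hασ.trans hσ) (by omega)).symm
      · left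
        refine ⟨⟨ρ, hc, ⟨G, ⟨(Finset.mem_insert.1 hG).resolve_left ?_, hρG⟩, ?_⟩, hσ⟩, hσα⟩
        · rintro rfl
          exact hρnα hρG
        · exact fun G' hG' => hGu G' ⟨Finset.mem_insert_of_mem hG'.1, hG'.2⟩
  · rintro (⟨⟨ρ, hc, ⟨G, ⟨hG, hρG⟩, hGu⟩, hσ⟩, hσα⟩ | ⟨hσ, hασ⟩)
    · refine ⟨ρ, hc, ⟨G, ⟨Finset.mem_insert_of_mem hG, hρG⟩, ?_⟩, hσ⟩
      rintro G' ⟨hG', hρG'⟩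
      rcases Finset.mem_insert.1 hG' with rfl | hG'
      · exact absurd (hσ.trans ((Finset.subset_insert_iff_of_notMem
          (fun hvρ => hv G hG (hρG hvρ))).1 hρG')) hσα
      · exact hGu G' ⟨hG', hρG'⟩
    · obtain ⟨a, haα, haσ⟩ := Finset.not_subset.1 hασ
      have hva : v ≠ a := fun h => hvα (h ▸ haα)
      refine ⟨(insert v α).erase a, ?_, ⟨insert v α, ⟨Finset.mem_insert_self _ _,
        Finset.erase_subset _ _⟩, ?_⟩, Finset.subset_erase.2 ⟨hσ, haσ⟩⟩
      · rw [Finset.card_erase_of_mem (Finset.mem_insert_of_mem haα), hcard]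
        rfl
      · rintro G' ⟨hG', hs⟩
        rcases Finset.mem_insert.1 hG' with rfl | hG'
        · rfl
        · exact absurd (hs (Finset.mem_erase.2 ⟨hva, Finset.mem_insert_self v α⟩)) (hv G' hG')

/-- All faces of codimension at least two of a stacked ball lie in its boundary. -/
lemma IsStackedFamily.mem_boundary (h : IsStackedFamily d 𝓕) :
    ∀ σ ∈ generated 𝓕, σ.card ≤ d → σ ∈ (generated 𝓕).boundary (d + 1) := by
  induction h with
  | single s hs =>
    intro σ hσ hc
    rw [boundary_generated_singleton hs]
    rw [generated_singleton] at hσ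
    refine Finset.ssubset_iff_subset_ne.2 ⟨hσ, ?_⟩
    rintro rfl
    omega
  | attach 𝓕 α v h hα hu hv ih =>
    intro σ hσ hc
    rw [mem_boundary_generated_attach h.card_eq hα hu hv]
    have hασ : ¬ α ⊆ σ := fun h => by
      have := Finset.card_le_card h
      omega
    rcases mem_generated_insert.1 hσ with hσ | hσ
    · exact Or.inr ⟨hσ, hασ⟩
    · by_cases hσα : σ ⊆ α
      · exact Or.inr ⟨hσα.trans (Finset.subset_insert v α), hασ⟩
      · exact Or.inl ⟨ih σ hσ hc, hσα⟩

lemma IsStackedFamily.hasDim_generated (h : IsStackedFamily d 𝓕) :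
    (generated 𝓕).HasDim (d + 1) := by
  constructor
  · cases h with
    | single s hs => exact ⟨s, ⟨s, Finset.mem_singleton_self s, subset_rfl⟩, hs⟩
    | attach 𝓕 α v h hα hu hv =>
      obtain ⟨G, hG, -⟩ := hu
      exact ⟨G, ⟨G, Finset.mem_insert_of_mem hG.1, subset_rfl⟩, h.card_eq G hG.1⟩
  · rintro σ ⟨G, hG, hσ⟩
    exact (Finset.card_le_card hσ).trans (h.card_eq G hG).le

lemma IsStackedFamily.hasDim_boundary (h : IsStackedFamily d 𝓕) :
    ((generated 𝓕).boundary (d + 1)).HasDim d := by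
  refine ⟨?_, fun σ hσ => card_le_of_mem_boundary hσ⟩
  cases h with
  | single s hs =>
    rw [boundary_generated_singleton hs]
    obtain ⟨a, ha⟩ : s.Nonempty := Finset.card_pos.1 (by omega)
    exact ⟨s.erase a, Finset.erase_ssubset ha, by rw [Finset.card_erase_of_mem ha, hs]; rfl⟩
  | attach 𝓕 α v h hα hu hv =>
    obtain ⟨a, ha⟩ : α.Nonempty := Finset.card_pos.1 (by omega)
    obtain ⟨G, ⟨hG, hαG⟩, -⟩ := id hu
    refine ⟨(insert v α).erase a, (mem_boundary_generated_attach h.card_eq hα hu hv).2 (Or.inr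
      ⟨Finset.erase_subset _ _, fun hs => Finset.notMem_erase a _ (hs ha)⟩), ?_⟩
    rw [Finset.card_erase_of_mem (Finset.mem_insert_of_mem ha),
      Finset.card_insert_of_notMem (fun h => hv G hG (hαG h)), hα]
    rfl

/-- Attaching a simplex to a stacked ball is a bistellar move of index `0` on the boundary. -/
lemma IsStackedFamily.isBistellarMove (h : IsStackedFamily d 𝓕) {α : Finset V} {v : V}
    (hα : α.card = d + 1) (hu : ∃! G, G ∈ 𝓕 ∧ α ⊆ G) (hv : ∀ G ∈ 𝓕, v ∉ G) :
    IsBistellarMove d ((generated 𝓕).boundary (d + 1))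
      ((generated (insert (insert v α) 𝓕)).boundary (d + 1)) α {v} := by
  obtain ⟨G₀, ⟨hG₀, hαG₀⟩, -⟩ := id hu
  have hvα : v ∉ α := fun h => hv G₀ hG₀ (hαG₀ h)
  have hαX := mem_boundary_of_existsUnique h.card_eq hα hu
  have hvX : ∀ σ ∈ (generated 𝓕).boundary (d + 1), v ∉ σ := fun σ hσ hvσ => by
    obtain ⟨G, hG, hσG⟩ := mem_generated_of_mem_boundary hσ
    exact hv G hG (hσG hvσ)
  refine ⟨h.hasDim_boundary, Finset.card_pos.1 (by omega), Finset.singleton_nonempty v,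
    Finset.disjoint_singleton_right.2 hvα, by rw [hα, Finset.card_singleton], ?_, ?_⟩
  · intro σ hσ
    unfold InSimplexJoinBoundary
    rw [Finset.singleton_subset_iff]
    refine ⟨fun h => ⟨hσ, hvX σ h⟩, fun h => FinComplex.down_closed _ α hαX σ ?_⟩
    rw [Finset.union_comm, ← Finset.insert_eq] at hσ
    exact (Finset.subset_insert_iff_of_notMem h.2).1 hσ
  · intro σ
    unfold InSimplexJoinBoundary
    rw [mem_boundary_generated_attach h.card_eq hα hu hv, Finset.singleton_subset_iff,
      Finset.union_comm α, ← Finset.insert_eq]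
    refine or_congr_left (and_congr_right fun hσ => not_congr ?_)
    rw [and_iff_left (hvX σ hσ), Finset.subset_insert_iff_of_notMem (hvX σ hσ)]

theorem IsStackedFamily.isStellated (h : IsStackedFamily d 𝓕) :
    IsStellated 1 d ((generated 𝓕).boundary (d + 1)) := by
  induction h with
  | single s hs =>
    rw [boundary_generated_singleton hs]
    exact IsStellated.standard _ ⟨s, hs, fun σ => Iff.rfl⟩
  | attach 𝓕 α v h hα hu hv ih =>
    exact IsStellated.move _ _ α {v} 0 ih (h.isBistellarMove hα hu hv) (Finset.card_singleton v)
      Nat.zero_lt_one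

/-- A move of index 0 on two points just replaces one of them. Dimension 0 is separate because a
stacked ball there may have interior vertices, so the vertex of a move need not be new to the ball.
-/
lemma isStandardSphere_of_isStellated_zero {X : FinComplex V} (h : IsStellated 1 0 X) :
    IsStandardSphere 0 X := by
  induction h with
  | standard X h => exact h
  | move X Y α β i _ hm hβ hi ih =>
    obtain ⟨s, hs, hX⟩ := ih
    obtain ⟨-, -, -, hαβ, hc, hind, hY⟩ := hm
    obtain ⟨v, rfl⟩ := Finset.card_eq_one.1 (show β.card = 1 by omega)
    obtain ⟨a, rfl⟩ := Finset.card_eq_one.1 (show α.card = 1 by omega)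
    have hav : a ≠ v := by simpa using hαβ
    have has : {a} ⊂ s := (hX _).1 ((hind _ Finset.subset_union_left).2
      ⟨Finset.subset_union_left, by simpa using hav.symm⟩)
    have hvs : v ∉ s := by
      intro hvs
      have : {v} ∈ X := (hX _).2 (Finset.ssubset_iff_subset_ne.2
        ⟨by simpa using hvs, fun h => by rw [← h] at hs; simp at hs⟩)
      exact ((hind _ Finset.subset_union_right).1 this).2 subset_rfl
    obtain ⟨b, hb, hba⟩ := Finset.exists_of_ssubset has
    have hba : a ≠ b := fun h => hba (by simp [h])
    have hsab : s = {a, b} := by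
      refine (Finset.eq_of_subset_of_card_le ?_ ?_).symm
      · intro x hx
        rcases Finset.mem_insert.1 hx with rfl | hx
        · exact has.subset (Finset.mem_singleton_self x)
        · rwa [Finset.mem_singleton.1 hx]
      · rw [hs, Finset.card_pair hba]
    have hpair : ∀ (x y : V), x ≠ y → ∀ σ : Finset V,
        σ ⊂ {x, y} ↔ σ = ∅ ∨ σ = {x} ∨ σ = {y} := by
      intro x y hxy σ
      constructor
      · intro h
        obtain ⟨z, hz, hzσ⟩ := Finset.exists_of_ssubset h
        rcases Finset.mem_insert.1 hz with rfl | hz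
        · have := (Finset.subset_insert_iff_of_notMem hzσ).1 h.subset
          exact (Finset.subset_singleton_iff.1 this).elim Or.inl fun h => Or.inr (Or.inr h)
        · rw [Finset.mem_singleton.1 hz] at hzσ
          have h' := h.subset
          rw [Finset.pair_comm] at h'
          have := (Finset.subset_insert_iff_of_notMem hzσ).1 h'
          exact (Finset.subset_singleton_iff.1 this).elim Or.inl fun h => Or.inr (Or.inl h)
      · rintro (rfl | rfl | rfl)
        · exact Finset.empty_ssubset.2 (by simp)
        · exact Finset.ssubset_iff_subset_ne.2 ⟨by simp, fun h => by
            simpa [hxy] using congrArg Finset.card h⟩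
        · exact Finset.ssubset_iff_subset_ne.2 ⟨by simp, fun h => by
            simpa [hxy] using congrArg Finset.card h⟩
    have hvb : v ≠ b := fun h => hvs (h ▸ hb)
    refine ⟨{v, b}, Finset.card_pair hvb, fun σ => ?_⟩
    rw [hY, hX, hsab, hpair a b hba, hpair v b hvb]
    unfold InSimplexJoinBoundary
    constructor
    · rintro (⟨rfl | rfl | rfl, h⟩ | ⟨h1, h2⟩)
      · exact Or.inl rfl
      · exact absurd ⟨Finset.subset_union_left, by simpa using hav.symm⟩ h
      · exact Or.inr (Or.inr rfl)
      · rw [Finset.singleton_subset_iff] at h2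
        rw [← Finset.insert_eq, Finset.pair_comm, Finset.subset_insert_iff_of_notMem h2,
          Finset.subset_singleton_iff] at h1
        exact h1.elim Or.inl fun h => Or.inr (Or.inl h)
    · rintro (rfl | rfl | rfl)
      · exact Or.inr ⟨by simp, by simp⟩
      · exact Or.inr ⟨by simp, by simpa using hav⟩
      · refine Or.inl ⟨Or.inr (Or.inr rfl), fun h => ?_⟩
        have := h.1 (Finset.mem_singleton_self b)
        simp only [Finset.mem_union, Finset.mem_singleton] at this
        rcases this with h | h
        · exact hba h.symm
        · exact hvb h.symm

/-- A `1`-stellated sphere is the boundary of a stacked ball. -/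
theorem exists_isStackedFamily_of_isStellated {X : FinComplex V} (h : IsStellated 1 d X) :
    ∃ 𝓕 : Finset (Finset V), IsStackedFamily d 𝓕 ∧ (generated 𝓕).boundary (d + 1) = X := by
  have hstd : ∀ X : FinComplex V, IsStandardSphere d X →
      ∃ 𝓕 : Finset (Finset V), IsStackedFamily d 𝓕 ∧ (generated 𝓕).boundary (d + 1) = X := by
    rintro X ⟨s, hs, hX⟩
    refine ⟨{s}, IsStackedFamily.single s hs, ?_⟩
    rw [boundary_generated_singleton hs]
    exact ext_mem fun σ => (hX σ).symm
  rcases Nat.eq_zero_or_pos d with rfl | hd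
  · exact hstd X (isStandardSphere_of_isStellated_zero h)
  induction h with
  | standard X h => exact hstd X h
  | move X Y α β i _ hm hβ hi ih =>
    obtain ⟨𝓕, h𝓕, rfl⟩ := ih
    obtain ⟨v, rfl⟩ := Finset.card_eq_one.1 (show β.card = 1 by omega)
    obtain ⟨-, -, -, hαv, hc, hind, hY⟩ := id hm
    have hα : α.card = d + 1 := by
      rw [Finset.card_singleton] at hc
      omega
    have hvα : v ∉ α := Finset.disjoint_singleton_right.1 hαv
    have hαX := (hind α Finset.subset_union_left).2 ⟨Finset.subset_union_left, by simpa using hvα⟩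
    have hu : ∃! G, G ∈ 𝓕 ∧ α ⊆ G := by
      obtain ⟨ρ, hρ, hu, hαρ⟩ := (mem_boundary_generated h𝓕.card_eq).1 hαX
      rwa [Finset.eq_of_subset_of_card_le hαρ (by omega)]
    -- As `d ≥ 1`, a vertex of the ball lies on the boundary, whereas the move requires that `{v}`
    -- is not a face there.
    have hv : ∀ G ∈ 𝓕, v ∉ G := by
      intro G hG hvG
      have := h𝓕.mem_boundary {v} ⟨G, hG, by simpa using hvG⟩ (by rwa [Finset.card_singleton])
      exact ((hind _ Finset.subset_union_right).1 this).2 subset_rfl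
    refine ⟨_, h𝓕.attach 𝓕 α v hα hu hv, ext_mem fun σ => ?_⟩
    rw [(h𝓕.isBistellarMove hα hu hv).2.2.2.2.2.2 σ, hY σ]

end StackedFamily

/-! ### Stacked families generate `1`-stacked homology balls -/

section StackedBall

variable {V : Type*} [LinearOrder V] {d : ℕ} {𝓕 : Finset (Finset V)}

/-- The link of the gluing ridge consists of two points: `v` and the vertex opposite `α` in the
unique old member containing `α`. -/
lemma reducedBetti_link_generated_attach (F : Type*) [Field F] (h : ∀ G ∈ 𝓕, G.card = d + 2)
    {α : Finset V} {v : V} (hα : α.card = d + 1) (hu : ∃! G, G ∈ 𝓕 ∧ α ⊆ G)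
    (hv : ∀ G ∈ 𝓕, v ∉ G) (m : ℕ) :
    ((generated (insert (insert v α) 𝓕)).link α).reducedBetti F m = if m = 1 then 1 else 0 := by
  obtain ⟨G, ⟨hG, hαG⟩, hGu⟩ := id hu
  obtain ⟨w, hw⟩ : ∃ w, G = insert w α := by
    obtain ⟨w, hw⟩ := Finset.card_eq_one.1 (show (G \ α).card = 1 by
      rw [Finset.card_sdiff_of_subset hαG, h G hG, hα]
      omega)
    exact ⟨w, by rw [Finset.insert_eq, ← hw, Finset.sdiff_union_of_subset hαG]⟩
  have hwα : w ∉ α := fun hwα => by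
    have := h G hG
    rw [hw, Finset.insert_eq_of_mem hwα] at this
    omega
  have hvα : v ∉ α := fun h => hv G hG (hαG h)
  have hwv : w ≠ v := by
    rintro rfl
    exact hv G hG (hw ▸ Finset.mem_insert_self w α)
  have key : ∀ τ : Finset V, Disjoint τ α → ∀ x, τ ⊆ insert x α → τ ⊆ {x} := by
    intro τ hd x hτ y hy
    exact Finset.mem_singleton.2 ((Finset.mem_insert.1 (hτ hy)).resolve_right
      (Finset.disjoint_left.1 hd hy))
  have hlink : (generated (insert (insert v α) 𝓕)).link α = simplexBoundary {w, v} := by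
    refine ext_mem fun τ => ?_
    rw [mem_link, mem_generated_insert, mem_simplexBoundary]
    constructor
    · rintro ⟨hd, hτ⟩
      have hτ : τ ⊆ {v} ∨ τ ⊆ {w} := by
        rcases hτ with hτ | ⟨G', hG', hτ⟩
        · exact Or.inl (key τ hd v (Finset.union_subset_left hτ))
        · rw [hGu G' ⟨hG', Finset.union_subset_right hτ⟩, hw] at hτ
          exact Or.inr (key τ hd w (Finset.union_subset_left hτ))
      rcases hτ with hτ | hτ
      · exact lt_of_le_of_lt hτ (Finset.ssubset_iff_subset_ne.2
          ⟨by simp, fun h => by simpa [hwv] using congrArg Finset.card h⟩)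
      · exact lt_of_le_of_lt hτ (Finset.ssubset_iff_subset_ne.2
          ⟨by simp, fun h => by simpa [hwv] using congrArg Finset.card h⟩)
    · intro hτ
      refine ⟨Disjoint.mono_left hτ.subset (by simp [hvα, hwα]), ?_⟩
      obtain ⟨z, hz, hzτ⟩ := Finset.exists_of_ssubset hτ
      have hsub := hτ.subset
      rcases Finset.mem_insert.1 hz with rfl | hz
      · left
        have := (Finset.subset_insert_iff_of_notMem hzτ).1 hsub
        rw [Finset.insert_eq]
        exact Finset.union_subset_union_left this
      · right
        rw [Finset.mem_singleton.1 hz] at hzτ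
        rw [Finset.pair_comm] at hsub
        have := (Finset.subset_insert_iff_of_notMem hzτ).1 hsub
        refine ⟨G, hG, ?_⟩
        rw [hw, Finset.insert_eq]
        exact Finset.union_subset_union_left this
  rw [hlink, reducedBetti_simplexBoundary (by simp), Finset.card_pair hwv]
  congr 1
  apply propext
  omega

/-- The Betti numbers of the links of the faces of a stacked ball, and of its boundary. -/
theorem IsStackedFamily.reducedBetti_link (F : Type*) [Field F] (h : IsStackedFamily d 𝓕) :
    (∀ σ ∈ (generated 𝓕).boundary (d + 1), ∀ m : ℕ,
      (((generated 𝓕).boundary (d + 1)).link σ).reducedBetti F m =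
        if m + σ.card = d + 1 then 1 else 0) ∧
    (∀ σ ∈ (generated 𝓕).boundary (d + 1), ∀ m : ℕ,
      ((generated 𝓕).link σ).reducedBetti F m = 0) ∧
    ∀ σ ∈ generated 𝓕, σ ∉ (generated 𝓕).boundary (d + 1) → ∀ m : ℕ,
      ((generated 𝓕).link σ).reducedBetti F m = if m + σ.card = d + 2 then 1 else 0 := by
  have hself : ∀ s : Finset V, s.card = d + 2 → ∀ m : ℕ,
      ((fullSimplex s).link s).reducedBetti F m = if m + s.card = d + 2 then 1 else 0 := by
    intro s hs m
    rw [reducedBetti_link_fullSimplex_self F (Finset.card_pos.1 (by omega)), hs]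
    congr 1
    apply propext
    omega
  have hbd : ∀ s : Finset V, s.card = d + 2 → ∀ σ, σ ⊂ s → ∀ m : ℕ,
      ((simplexBoundary s).link σ).reducedBetti F m = if m + σ.card = d + 1 then 1 else 0 := by
    intro s hs σ hσ m
    rw [reducedBetti_link_simplexBoundary F hσ, hs]
    congr 1
    apply propext
    omega
  induction h with
  | single s hs =>
    rw [boundary_generated_singleton hs, generated_singleton]
    refine ⟨hbd s hs, fun σ hσ => reducedBetti_link_fullSimplex F hσ, fun σ hσ hσb m => ?_⟩
    rw [(eq_or_ssubset_of_subset (mem_fullSimplex.1 hσ)).resolve_right hσb]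
    exact hself s hs m
  | attach 𝓕 α v h hα hu hv ih =>
    obtain ⟨ih1, ih2, ih3⟩ := ih
    have hB := fun σ => mem_generated_insert (𝓕 := 𝓕) (s := insert v α) (σ := σ)
    have hY := fun σ => mem_boundary_generated_attach h.card_eq hα hu hv (σ := σ)
    have hαX := mem_boundary_of_existsUnique h.card_eq hα hu
    have hsub := fun σ (hσ : σ ∈ (generated 𝓕).boundary (d + 1)) =>
      mem_generated_of_mem_boundary hσ
    have hvB : ∀ σ ∈ generated 𝓕, v ∉ σ := fun σ ⟨G, hG, hσ⟩ hvσ => hv G hG (hσ hvσ)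
    have hvα : v ∉ α := hvB α (hsub α hαX)
    have hcard : (insert v α).card = d + 2 := by rw [Finset.card_insert_of_notMem hvα, hα]
    have hins : ∀ σ : Finset V, v ∈ σ → σ ⊆ insert v α → (¬ α ⊆ σ ↔ σ ⊂ insert v α) := by
      intro σ hvσ hσ
      rw [Finset.ssubset_def, and_iff_right hσ, Finset.insert_subset_iff, and_iff_right hvσ]
    have hlinkB : ∀ σ, v ∈ σ → (generated (insert (insert v α) 𝓕)).link σ =
        (fullSimplex (insert v α)).link σ := by
      intro σ hvσ
      refine link_congr fun τ hτ => ?_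
      rw [hB, mem_fullSimplex, or_iff_left fun h => hvB τ h (hτ hvσ)]
    have hlinkB' : ∀ σ, v ∉ σ → ¬ σ ⊆ α → (generated (insert (insert v α) 𝓕)).link σ =
        (generated 𝓕).link σ := by
      intro σ hvσ hσα
      refine link_congr fun τ hτ => ?_
      rw [hB, or_iff_right fun h => hσα ((Finset.subset_insert_iff_of_notMem hvσ).1 (hτ.trans h))]
    -- Faces containing `v` see only the new simplex, and faces not inside `insert v α` only the old
    -- ball. The real cases are the proper faces of `α`, treated by subdivision and attachment, and
    -- `α` itself, which has become interior.
    refine ⟨fun σ hσ m => ?_, fun σ hσ m => ?_, fun σ hσ hσb m => ?_⟩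
    · by_cases hvσ : v ∈ σ
      · have hσs := ((hY σ).1 hσ).resolve_left fun h => hvB σ (hsub σ h.1) hvσ
        rw [← hbd _ hcard σ ((hins σ hvσ hσs.1).1 hσs.2)]
        congr 1
        refine link_congr fun τ hτ => ?_
        rw [hY, mem_simplexBoundary, or_iff_right fun h => hvB τ (hsub τ h.1) (hτ hvσ)]
        exact ⟨fun h => (hins τ (hτ hvσ) h.1).1 h.2,
          fun h => ⟨h.subset, (hins τ (hτ hvσ) h.subset).2 h⟩⟩
      · by_cases hσα : σ ⊆ α
        · have hσα' : σ ⊂ α := Finset.ssubset_def.2 ⟨hσα, ((hY σ).1 hσ).elim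
            (fun h => absurd hσα h.2) fun h => h.2⟩
          rw [reducedBetti_link_subdivide F hαX (fun τ hτ hατ =>
            (Finset.eq_of_subset_of_card_le hατ (hα ▸ card_le_of_mem_boundary hτ)).symm.subset)
            (fun τ hτ => hvB τ (hsub τ hτ)) hY hσα']
          exact ih1 σ (FinComplex.down_closed _ α hαX σ hσα) m
        · have hσX := (((hY σ).1 hσ).resolve_right fun h =>
            hσα ((Finset.subset_insert_iff_of_notMem hvσ).1 h.1)).1
          rw [← ih1 σ hσX]
          congr 1
          refine link_congr fun τ hτ => ?_
          have hτα : ¬ τ ⊆ α := fun h => hσα (hτ.trans h)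
          rw [hY, and_iff_left hτα, or_iff_left fun h =>
            hσα ((Finset.subset_insert_iff_of_notMem hvσ).1 (hτ.trans h.1))]
    · by_cases hvσ : v ∈ σ
      · have hσs := ((hY σ).1 hσ).resolve_left fun h => hvB σ (hsub σ h.1) hvσ
        rw [hlinkB σ hvσ]
        exact reducedBetti_link_fullSimplex F ((hins σ hvσ hσs.1).1 hσs.2) m
      · by_cases hσα : σ ⊆ α
        · have hσα' : σ ⊂ α := Finset.ssubset_def.2 ⟨hσα, ((hY σ).1 hσ).elim
            (fun h => absurd hσα h.2) fun h => h.2⟩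
          rw [← reducedBetti_link_attach F (hsub α hαX) hvB hB hσα']
          exact ih2 σ (FinComplex.down_closed _ α hαX σ hσα) m
        · have hσX := (((hY σ).1 hσ).resolve_right fun h =>
            hσα ((Finset.subset_insert_iff_of_notMem hvσ).1 h.1)).1
          rw [hlinkB' σ hvσ hσα]
          exact ih2 σ hσX m
    · rw [hY, not_or, not_and, not_not, not_and, not_not] at hσb
      by_cases hvσ : v ∈ σ
      · have hσs := ((hB σ).1 hσ).resolve_right fun h => hvB σ h hvσ
        have : σ = insert v α :=
          subset_antisymm hσs (Finset.insert_subset hvσ (hσb.2 hσs))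
        rw [hlinkB σ hvσ, this]
        exact hself _ hcard m
      · by_cases hσα : σ ⊆ α
        · have : σ = α :=
            subset_antisymm hσα (hσb.2 (hσα.trans (Finset.subset_insert v α)))
          rw [this, reducedBetti_link_generated_attach F h.card_eq hα hu hv, hα]
          congr 1
          apply propext
          omega
        · rw [hlinkB' σ hvσ hσα]
          refine ih3 σ (((hB σ).1 hσ).resolve_left fun h =>
            hσα ((Finset.subset_insert_iff_of_notMem hvσ).1 h)) (fun h => hσα (hσb.1 h)) m

theorem IsStackedFamily.isStackedSphere (h : IsStackedFamily d 𝓕) :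
    IsStackedSphere 1 d ((generated 𝓕).boundary (d + 1)) := by
  -- Any field would do here; a single one suffices for the definition.
  obtain ⟨h1, h2, h3⟩ := h.reducedBetti_link ℚ
  have hS : IsHomologySphereOver ℚ d ((generated 𝓕).boundary (d + 1)) := ⟨h.hasDim_boundary, h1⟩
  exact ⟨⟨ℚ, inferInstance, hS⟩, generated 𝓕,
    ⟨⟨ℚ, inferInstance, h.hasDim_generated, hS, h2, h3⟩,
      fun σ hσ hc => h.mem_boundary σ hσ (Nat.le_of_succ_le_succ hc)⟩, rfl⟩

end StackedBall

/-! ### Coefficients of boundaries at ridges -/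

section ChainCoefficients

variable {V : Type*} [LinearOrder V] {F : Type*} [Field F]

lemma chainBoundary_single_apply_of_not_subset {ρ σ : Finset V} (h : ¬ ρ ⊆ σ) (c : F) :
    chainBoundary F (Finsupp.single σ c) ρ = 0 := by
  rw [chainBoundary_single, Finsupp.smul_apply, Finsupp.finsetSum_apply, Finset.sum_eq_zero,
    smul_zero]
  intro x _
  refine Finsupp.single_eq_of_ne ?_
  rintro rfl
  exact h (Finset.erase_subset x σ)

lemma chainBoundary_single_apply_ne_zero {ρ σ : Finset V} (h : ρ ⊆ σ)
    (hc : σ.card = ρ.card + 1) : chainBoundary F (Finsupp.single σ (1 : F)) ρ ≠ 0 := by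
  obtain ⟨x, hx⟩ := Finset.card_eq_one.1 (show (σ \ ρ).card = 1 by
    rw [Finset.card_sdiff_of_subset h, hc]
    omega)
  have hxσ : x ∈ σ := (Finset.mem_sdiff.1 (hx ▸ Finset.mem_singleton_self x)).1
  have hρ : ρ = σ.erase x := by
    rw [Finset.erase_eq, ← hx, Finset.sdiff_sdiff_eq_self h]
  rw [hρ, chainBoundary_single_apply_erase hxσ, one_mul]
  exact vertexSign_ne_zero F σ x

/-- Only simplices containing `ρ` contribute. This is the relation that carries coefficients of a
chain from one facet to the next across a ridge. -/
lemma chainBoundary_apply_of_two {c : Finset V →₀ F} {ρ G G' : Finset V} (hne : G ≠ G')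
    (h : ∀ σ, c σ ≠ 0 → ρ ⊆ σ → σ = G ∨ σ = G') :
    chainBoundary F c ρ = c G * chainBoundary F (Finsupp.single G 1) ρ +
      c G' * chainBoundary F (Finsupp.single G' 1) ρ := by
  have h1 : chainBoundary F c ρ =
      ∑ σ ∈ c.support, c σ * chainBoundary F (Finsupp.single σ 1) ρ := by
    conv_lhs => rw [← Finsupp.sum_single c, Finsupp.sum, map_sum, Finsupp.finsetSum_apply]
    refine Finset.sum_congr rfl fun σ _ => ?_
    rw [← smul_eq_mul, ← Finsupp.smul_apply, ← map_smul, Finsupp.smul_single, smul_eq_mul, mul_one]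
  rw [h1, ← Finset.sum_pair (f := fun σ => c σ * chainBoundary F (Finsupp.single σ 1) ρ) hne,
    Finset.sum_subset (Finset.subset_union_left (s₂ := ({G, G'} : Finset (Finset V)))),
    ← Finset.sum_subset (Finset.subset_union_right (s₁ := c.support))]
  · intro σ _ hσ
    by_cases hc : c σ = 0
    · rw [hc, zero_mul]
    · rw [chainBoundary_single_apply_of_not_subset, mul_zero]
      intro hρ
      rw [Finset.mem_insert, Finset.mem_singleton] at hσ
      exact hσ (h σ hc hρ)
  · intro σ _ hσ
    rw [Finsupp.notMem_support_iff.1 hσ, zero_mul]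

/-- A complex of dimension `0` whose reduced homology in dimension `0` has rank one has at most
two vertices. -/
lemma eq_of_reducedBetti_one_eq_one {X : FinComplex V} (hX : ∀ σ ∈ X, σ.card ≤ 1)
    (h : X.reducedBetti F 1 = 1) {x y z : V} (hx : {x} ∈ X) (hy : {y} ∈ X) (hz : {z} ∈ X)
    (hxy : x ≠ y) (hxz : x ≠ z) : y = z := by
  by_contra hyz
  have hcyc : ∀ u, {u} ∈ X → Finsupp.single {x} (1 : F) - Finsupp.single {u} 1 ∈ X.cycles F 1 := by
    intro u hu
    refine ⟨sub_mem (single_mem_chains hx (Finset.card_singleton x) 1)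
      (single_mem_chains hu (Finset.card_singleton u) 1), ?_⟩
    rw [SetLike.mem_coe, LinearMap.mem_ker, map_sub, chainBoundary_single, chainBoundary_single]
    simp [vertexSign, Finset.filter_singleton]
  unfold reducedBetti quotientRank at h
  rw [boundaries_eq_bot hX] at h
  obtain ⟨w, hw0, hw⟩ := finrank_eq_one_iff'.1 h
  obtain ⟨w, rfl⟩ := Submodule.Quotient.mk_surjective _ w
  -- There are no boundaries in this degree, so all cycles `[x] - [u]` are multiples of one `w`; for
  -- `u = y` and `u = z` this contradicts their independence.
  have key : ∀ u, {u} ∈ X →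
      ∃ t : F, t • w.1 = Finsupp.single {x} (1 : F) - Finsupp.single {u} 1 := by
    intro u hu
    obtain ⟨t, ht⟩ := hw (Submodule.Quotient.mk ⟨_, hcyc u hu⟩)
    rw [← Submodule.Quotient.mk_smul, Submodule.Quotient.eq] at ht
    exact ⟨t, sub_eq_zero.1 ((Submodule.mem_bot F).1 ht)⟩
  obtain ⟨t, ht⟩ := key y hy
  obtain ⟨t', ht'⟩ := key z hz
  have h1 := DFunLike.congr_fun ht {x}
  have h2 := DFunLike.congr_fun ht {z}
  have h3 := DFunLike.congr_fun ht' {z}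
  simp [hxy, hxz, hyz] at h1 h2 h3
  rcases h2 with h2 | h2
  · simp [h2] at h1
  · simp [h2] at h3

end ChainCoefficients

/-! ### A criterion for a family to be stacked -/

section Recognition

variable {V : Type*}

/-- Two members of `𝓕` are adjacent if they share a set of `n` vertices with the property `P`. -/
def RidgeAdj (𝓕 : Finset (Finset V)) (n : ℕ) (P : Finset V → Prop) (G G' : Finset V) : Prop :=
  G ∈ 𝓕 ∧ G' ∈ 𝓕 ∧ ∃ ρ : Finset V, P ρ ∧ ρ.card = n ∧ ρ ⊆ G ∧ ρ ⊆ G'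

lemma RidgeAdj.symm {𝓕 : Finset (Finset V)} {n : ℕ} {P : Finset V → Prop} {G G' : Finset V}
    (h : RidgeAdj 𝓕 n P G G') : RidgeAdj 𝓕 n P G' G := by
  obtain ⟨hG, hG', ρ, hP, hc, h1, h2⟩ := h
  exact ⟨hG', hG, ρ, hP, hc, h2, h1⟩

lemma RidgeAdj.mono {𝓕 𝓖 : Finset (Finset V)} (h𝓕 : 𝓕 ⊆ 𝓖) {n : ℕ} {P Q : Finset V → Prop}
    (hPQ : ∀ ρ, P ρ → Q ρ) {G G' : Finset V} (h : RidgeAdj 𝓕 n P G G') :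
    RidgeAdj 𝓖 n Q G G' := by
  obtain ⟨hG, hG', ρ, hP, hc⟩ := h
  exact ⟨h𝓕 hG, h𝓕 hG', ρ, hPQ ρ hP, hc⟩

lemma reflTransGen_ridgeAdj_symm {𝓕 : Finset (Finset V)} {n : ℕ} {P : Finset V → Prop}
    {G G' : Finset V} (h : Relation.ReflTransGen (RidgeAdj 𝓕 n P) G G') :
    Relation.ReflTransGen (RidgeAdj 𝓕 n P) G' G := by
  induction h with
  | refl => exact Relation.ReflTransGen.refl
  | tail _ hbc ih => exact Relation.ReflTransGen.head hbc.symm ih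

lemma IsStackedFamily.nonempty [DecidableEq V] {d : ℕ} {𝓕 : Finset (Finset V)}
    (h : IsStackedFamily d 𝓕) : 𝓕.Nonempty := by
  cases h with
  | single s hs => exact Finset.singleton_nonempty s
  | attach 𝓕 α v h hα hu hv => exact Finset.insert_nonempty _ _

/-- The facets of a stacked ball are connected through ridges. -/
lemma IsStackedFamily.reflTransGen [DecidableEq V] {d : ℕ} {𝓕 : Finset (Finset V)}
    (h : IsStackedFamily d 𝓕) : ∀ G ∈ 𝓕, ∀ G' ∈ 𝓕,
      Relation.ReflTransGen (RidgeAdj 𝓕 (d + 1) fun _ => True) G G' := by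
  induction h with
  | single s hs =>
    intro G hG G' hG'
    rw [Finset.mem_singleton.1 hG, Finset.mem_singleton.1 hG']
  | attach 𝓕 α v h hα hu hv ih =>
    obtain ⟨G₀, ⟨hG₀, hαG₀⟩, -⟩ := hu
    have hsub : 𝓕 ⊆ insert (insert v α) 𝓕 := Finset.subset_insert _ _
    have key : ∀ G ∈ insert (insert v α) 𝓕, Relation.ReflTransGen
        (RidgeAdj (insert (insert v α) 𝓕) (d + 1) fun _ => True) G₀ G := by
      intro G hG
      rcases Finset.mem_insert.1 hG with rfl | hG
      · exact Relation.ReflTransGen.single ⟨hsub hG₀, Finset.mem_insert_self _ _, α, trivial, hα,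
          hαG₀, Finset.subset_insert v α⟩
      · exact Relation.ReflTransGen.mono (fun _ _ => RidgeAdj.mono hsub fun _ => id) _ _
          (ih G₀ hG₀ G hG)
    intro G hG G' hG'
    exact (reflTransGen_ridgeAdj_symm (key G hG)).trans (key G' hG')

/-- A family `𝓕` of sets of `d + 2` vertices is stacked if each ridge lies in at most two of its
members, the members containing a given set of at most one vertex are connected through ridges that
contain it, and removing a ridge separates the two members that contain it. -/
theorem isStackedFamily_of_separating [DecidableEq V] {d : ℕ} {𝓕 : Finset (Finset V)}
    (hne : 𝓕.Nonempty) (hcard : ∀ G ∈ 𝓕, G.card = d + 2)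
    (htwo : ∀ ρ : Finset V, ρ.card = d + 1 → ∀ G ∈ 𝓕, ∀ G₁ ∈ 𝓕, ∀ G₂ ∈ 𝓕, ρ ⊆ G → ρ ⊆ G₁ →
      ρ ⊆ G₂ → G ≠ G₁ → G ≠ G₂ → G₁ = G₂)
    (hconn : ∀ σ : Finset V, σ.card ≤ 1 → ∀ G ∈ 𝓕, ∀ G' ∈ 𝓕, σ ⊆ G → σ ⊆ G' →
      Relation.ReflTransGen (RidgeAdj 𝓕 (d + 1) (σ ⊆ ·)) G G')
    (hsep : ∀ α : Finset V, α.card = d + 1 → ∀ G ∈ 𝓕, ∀ G' ∈ 𝓕, α ⊆ G → α ⊆ G' → G ≠ G' →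
      ¬ Relation.ReflTransGen (RidgeAdj 𝓕 (d + 1) (· ≠ α)) G G') :
    IsStackedFamily d 𝓕 := by
  classical
  obtain ⟨G₀, hG₀⟩ := hne
  -- A stacked subfamily of maximal size; if it were proper, ridge-connectedness would give a member
  -- `G'` outside it adjacent to some `G` inside, and `G'` could be attached.
  obtain ⟨𝓖, h𝓖, hmax⟩ := (𝓕.powerset.filter (IsStackedFamily d)).exists_max_image Finset.card
    ⟨{G₀}, Finset.mem_filter.2 ⟨Finset.mem_powerset.2 (Finset.singleton_subset_iff.2 hG₀),
      IsStackedFamily.single G₀ (hcard G₀ hG₀)⟩⟩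
  obtain ⟨hsub, hst⟩ := Finset.mem_filter.1 h𝓖
  rw [Finset.mem_powerset] at hsub
  by_cases heq : 𝓖 = 𝓕
  · rwa [← heq]
  exfalso
  obtain ⟨H, hH, hH𝓖⟩ := Finset.exists_of_ssubset (Finset.ssubset_iff_subset_ne.2 ⟨hsub, heq⟩)
  obtain ⟨K, hK⟩ := hst.nonempty
  obtain ⟨G, G', hG, hG', hadj⟩ : ∃ G G', G ∈ 𝓖 ∧ G' ∉ 𝓖 ∧
      RidgeAdj 𝓕 (d + 1) (∅ ⊆ ·) G G' := by
    by_contra! hno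
    have : ∀ G', Relation.ReflTransGen (RidgeAdj 𝓕 (d + 1) (∅ ⊆ ·)) K G' → G' ∈ 𝓖 := by
      intro G' h
      induction h with
      | refl => exact hK
      | tail _ hbc ih =>
        by_contra hn
        exact hno _ _ ih hn hbc
    exact hH𝓖 (this H (hconn ∅ (by simp) K (hsub hK) H hH (by simp) (by simp)))
  obtain ⟨hG𝓕, hG'𝓕, α, -, hα, hαG, hαG'⟩ := hadj
  have hGG' : G ≠ G' := fun h => hG' (h ▸ hG)
  have huniq : ∀ L ∈ 𝓖, α ⊆ L → L = G := fun L hL hαL =>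
    htwo α hα G' hG'𝓕 L (hsub hL) G hG𝓕 hαG' hαL hαG (fun h => hG' (h ▸ hL)) hGG'.symm
  obtain ⟨v, hv⟩ := Finset.card_eq_one.1 (show (G' \ α).card = 1 by
    rw [Finset.card_sdiff_of_subset hαG', hcard G' hG'𝓕, hα]
    omega)
  have hG'v : G' = insert v α := by
    rw [Finset.insert_eq, ← hv, Finset.sdiff_union_of_subset hαG']
  have hvα : v ∉ α := (Finset.mem_sdiff.1 (hv ▸ Finset.mem_singleton_self v)).2
  -- If `v` were in `L`, one could go from `G` to `L` inside `𝓖`, then from `L` to `G'` in the star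
  -- of `v`, whose ridges differ from `α` because `v ∉ α`. This contradicts separation.
  have hnew : ∀ L ∈ 𝓖, v ∉ L := by
    intro L hL hvL
    refine hsep α hα G hG𝓕 G' hG'𝓕 hαG hαG' hGG' (Relation.ReflTransGen.trans (b := L) ?_ ?_)
    · have hpath := hst.reflTransGen G hG L hL
      clear hvL hL
      induction hpath with
      | refl => exact Relation.ReflTransGen.refl
      | @tail M N _ hMN ih =>
        obtain ⟨hM, hN, ρ, -, hρ, hρM, hρN⟩ := hMN
        -- Within `𝓖` only `G` contains `α`, so a step across `α` ends at `G`, and the path so far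
        -- can be dropped.
        by_cases hρα : ρ = α
        · rw [huniq N hN (hρα ▸ hρN)]
        · exact ih.tail ⟨hsub hM, hsub hN, ρ, hρα, hρ, hρM, hρN⟩
    · refine Relation.ReflTransGen.mono (fun _ _ => RidgeAdj.mono subset_rfl ?_) _ _
        (hconn {v} (by simp) L (hsub hL) G' hG'𝓕 (by simpa using hvL) (by simp [hG'v]))
      rintro ρ hρ rfl
      exact hvα (hρ (Finset.mem_singleton_self v))
  have hbig := hmax (insert (insert v α) 𝓖) (Finset.mem_filter.2
    ⟨Finset.mem_powerset.2 (Finset.insert_subset (hG'v ▸ hG'𝓕) hsub),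
      hst.attach 𝓖 α v hα ⟨G, ⟨hG, hαG⟩, fun L hL => huniq L hL.1 hL.2⟩ hnew⟩)
  rw [Finset.card_insert_of_notMem (hG'v ▸ hG')] at hbig
  omega

end Recognition

/-! ### Facets of a `1`-stacked homology ball -/

section StackedBallFacets

/-- The faces of `X` with exactly `n` vertices. -/
noncomputable def facesOfCard {V : Type*} (X : FinComplex V) (n : ℕ) : Finset (Finset V) :=
  (X.finite_faces.subset (t := {σ | σ ∈ X ∧ σ.card = n}) fun _ h => h.1).toFinset

lemma mem_facesOfCard {V : Type*} {X : FinComplex V} {n : ℕ} {σ : Finset V} :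
    σ ∈ X.facesOfCard n ↔ σ ∈ X ∧ σ.card = n := by
  simp [facesOfCard]

lemma exists_eq_insert_of_card {V : Type*} [DecidableEq V] {ρ G : Finset V} (h : ρ ⊆ G)
    (hc : G.card = ρ.card + 1) : ∃ x, x ∉ ρ ∧ G = insert x ρ := by
  obtain ⟨x, hx⟩ := Finset.card_eq_one.1 (show (G \ ρ).card = 1 by
    rw [Finset.card_sdiff_of_subset h, hc]
    omega)
  exact ⟨x, (Finset.mem_sdiff.1 (hx ▸ Finset.mem_singleton_self x)).2,
    by rw [Finset.insert_eq, ← hx, Finset.sdiff_union_of_subset h]⟩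

lemma notMem_boundary_of_two {V : Type*} {B : FinComplex V} {n : ℕ} {ρ G G' : Finset V} (hρ : ρ.card = n)
    (hG : G ∈ B.facesOfCard (n + 1)) (hG' : G' ∈ B.facesOfCard (n + 1)) (h : ρ ⊆ G) (h' : ρ ⊆ G')
    (hne : G ≠ G') : ρ ∉ B.boundary n := by
  rintro ⟨ρ', -, hc, hu, hs⟩
  rw [← Finset.eq_of_subset_of_card_le hs (by omega)] at hu
  rw [mem_facesOfCard] at hG hG'
  exact hne (hu.unique ⟨hG.1, hG.2, h⟩ ⟨hG'.1, hG'.2, h'⟩)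

variable {V : Type*} [LinearOrder V] {F : Type*} [Field F] {d : ℕ} {B : FinComplex V}

variable (hB : IsHomologyBallOver F d B) (hst : ∀ σ ∈ B, σ.card ≤ d → σ ∈ B.boundary (d + 1))
include hB

/-- The link is acyclic or a homology sphere of positive dimension. This serves to make it
connected. -/
lemma reducedBetti_link_one_of_card_le {σ : Finset V} (hσ : σ ∈ B) (hc : σ.card ≤ d) :
    (B.link σ).reducedBetti F 1 = 0 := by
  by_cases h : σ ∈ B.boundary (d + 1)
  · exact hB.2.2.1 σ h 1
  · rw [hB.2.2.2 σ hσ h 1, if_neg (by omega)]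

/-- A ridge in two facets is interior, so its link is a zero-dimensional homology sphere and has at
most two vertices. -/
lemma facet_eq_of_subset {ρ G G₁ G₂ : Finset V} (hρ : ρ.card = d + 1)
    (hG : G ∈ B.facesOfCard (d + 2)) (hG₁ : G₁ ∈ B.facesOfCard (d + 2))
    (hG₂ : G₂ ∈ B.facesOfCard (d + 2)) (h : ρ ⊆ G) (h₁ : ρ ⊆ G₁) (h₂ : ρ ⊆ G₂)
    (hne₁ : G ≠ G₁) (hne₂ : G ≠ G₂) : G₁ = G₂ := by
  have hb := notMem_boundary_of_two hρ hG hG₁ h h₁ hne₁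
  rw [mem_facesOfCard] at hG hG₁ hG₂
  have hρB := B.down_closed G hG.1 ρ h
  obtain ⟨x, hx, rfl⟩ := exists_eq_insert_of_card h (by omega)
  obtain ⟨y, hy, rfl⟩ := exists_eq_insert_of_card h₁ (by omega)
  obtain ⟨z, hz, rfl⟩ := exists_eq_insert_of_card h₂ (by omega)
  have hlink : ∀ u, u ∉ ρ → insert u ρ ∈ B → {u} ∈ B.link ρ := fun u hu h =>
    ⟨Finset.disjoint_singleton_left.2 hu, by rwa [← Finset.insert_eq]⟩
  rw [eq_of_reducedBetti_one_eq_one (F := F) (X := B.link ρ) ?_ ?_ (hlink x hx hG.1)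
    (hlink y hy hG₁.1) (hlink z hz hG₂.1) (fun h => hne₁ (by rw [h])) (fun h => hne₂ (by rw [h]))]
  · rintro τ ⟨hd, hτ⟩
    have := hB.1.2 _ hτ
    rw [Finset.card_union_of_disjoint hd] at this
    omega
  · rw [hB.2.2.2 ρ hρB hb 1, if_pos (by omega)]

include hst in
-- Purity. Boundary faces lie in a ridge of a facet. By stackedness an interior face is a facet or a
-- ridge, and the link of an interior ridge has non-zero homology in dimension 0, hence a vertex.
lemma exists_facet {σ : Finset V} (hσ : σ ∈ B) : ∃ G ∈ B.facesOfCard (d + 2), σ ⊆ G := by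
  by_cases hb : σ ∈ B.boundary (d + 1)
  · obtain ⟨ρ, -, -, ⟨G, ⟨hG, hGc, hρG⟩, -⟩, hσρ⟩ := hb
    exact ⟨G, mem_facesOfCard.2 ⟨hG, hGc⟩, hσρ.trans hρG⟩
  · have h1 : d + 1 ≤ σ.card := by
      by_contra h
      exact hb (hst σ hσ (by omega))
    have h2 : σ.card ≤ d + 2 := hB.1.2 σ hσ
    rcases Nat.lt_or_ge σ.card (d + 2) with h3 | h3
    · have hbetti : (B.link σ).reducedBetti F 1 ≠ 0 := by
        rw [hB.2.2.2 σ hσ hb 1, if_pos (by omega)]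
        exact one_ne_zero
      obtain ⟨z, hz, hz0⟩ := exists_cycle_ne_zero hbetti
      obtain ⟨τ, hτ⟩ := Finsupp.ne_iff.1 hz0
      obtain ⟨⟨hd, hτB⟩, hτc⟩ := mem_chains.1 hz.1 τ hτ
      refine ⟨τ ∪ σ, mem_facesOfCard.2 ⟨hτB, ?_⟩, Finset.subset_union_right⟩
      rw [Finset.card_union_of_disjoint hd]
      omega
    · exact ⟨σ, mem_facesOfCard.2 ⟨hσ, by omega⟩, subset_rfl⟩

include hst in
/-- The facets containing a given face are connected through ridges containing that face. -/
lemma reflTransGen_ridgeAdj_star (n : ℕ) : ∀ σ : Finset V, σ.card + n = d + 1 →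
    ∀ G ∈ B.facesOfCard (d + 2), ∀ G' ∈ B.facesOfCard (d + 2), σ ⊆ G → σ ⊆ G' →
      Relation.ReflTransGen (RidgeAdj (B.facesOfCard (d + 2)) (d + 1) (σ ⊆ ·)) G G' := by
  induction n with
  | zero =>
    intro σ hσ G hG G' hG' h h'
    exact Relation.ReflTransGen.single ⟨hG, hG', σ, subset_rfl, hσ, h, h'⟩
  | succ n ih =>
    intro σ hσ G hG G' hG' h h'
    have hGB := mem_facesOfCard.1 hG
    have hGB' := mem_facesOfCard.1 hG'
    have hσB := B.down_closed G hGB.1 σ h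
    have hvert : ∀ H ∈ B, H.card = d + 2 → σ ⊆ H → ∃ x, x ∈ H ∧ x ∉ σ := by
      intro H _ hc hs
      exact Finset.exists_of_ssubset (Finset.ssubset_iff_subset_ne.2
        ⟨hs, fun h => by rw [h] at hσ; omega⟩)
    have hlink : ∀ H ∈ B, σ ⊆ H → ∀ x ∈ H, x ∉ σ → {x} ∈ B.link σ := fun H hH hs x hx hxσ =>
      ⟨Finset.disjoint_singleton_left.2 hxσ,
        B.down_closed H hH _ (Finset.union_subset (Finset.singleton_subset_iff.2 hx) hs)⟩
    obtain ⟨x, hxG, hxσ⟩ := hvert G hGB.1 hGB.2 h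
    obtain ⟨y, hyG, hyσ⟩ := hvert G' hGB'.1 hGB'.2 h'
    have hstep : ∀ u, u ∉ σ → ∀ H ∈ B.facesOfCard (d + 2), ∀ H' ∈ B.facesOfCard (d + 2),
        u ∈ H → u ∈ H' → σ ⊆ H → σ ⊆ H' →
        Relation.ReflTransGen (RidgeAdj (B.facesOfCard (d + 2)) (d + 1) (σ ⊆ ·)) H H' := by
      intro u hu H hH H' hH' huH huH' hs hs'
      refine Relation.ReflTransGen.mono (fun _ _ => RidgeAdj.mono subset_rfl
        fun ρ hρ => (Finset.subset_insert u σ).trans hρ) _ _ (ih (insert u σ) ?_ H hH H' hH'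
          (Finset.insert_subset huH hs) (Finset.insert_subset huH' hs'))
      rw [Finset.card_insert_of_notMem hu]
      omega
    -- Walk along edges of the link of `σ`. Each edge together with `σ` extends to a facet, and
    -- consecutive facets share a vertex `u` outside `σ`, so the induction hypothesis for `insert u
    -- σ` connects them.
    have hpath := reflTransGen_edge_of_reducedBetti_one
      (reducedBetti_link_one_of_card_le hB hσB (by omega))
      (hlink G hGB.1 h x hxG hxσ) (hlink G' hGB'.1 h' y hyG hyσ)
    clear hGB'
    induction hpath generalizing G' with
    | refl => exact hstep x hxσ G hG G' hG' hxG hyG h h'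
    | @tail b c _ hbc ihp =>
      obtain ⟨hd, hbcB⟩ := hbc
      obtain ⟨H, hH, hsH⟩ := exists_facet hB hst hbcB
      have hbσ : b ∉ σ := Finset.disjoint_left.1 hd (by simp)
      have hbH : b ∈ H := hsH (by simp)
      have hcH : c ∈ H := hsH (by simp)
      have hσH : σ ⊆ H := Finset.union_subset_right hsH
      exact (ihp H hH hσH hbH hbσ).trans (hstep c hyσ H hH G' hG' hcH hyG hσH h')

include hst in
/-- A `1`-stacked homology ball carries chains of facets `z` and `e`, where `∂z` is a non-zero cycle
of the boundary sphere and `∂e - α` is a chain of the boundary sphere. -/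
lemma exists_chains_of_ridge {α : Finset V} (hαB : α ∈ B) (hα : α.card = d + 1) :
    (∃ z ∈ B.chains F (d + 2), z ≠ 0 ∧
      chainBoundary F z ∈ (B.boundary (d + 1)).chains F (d + 1)) ∧
    ∃ e ∈ B.chains F (d + 2),
      Finsupp.single α 1 - chainBoundary F e ∈ (B.boundary (d + 1)).chains F (d + 1) := by
  obtain ⟨-, ⟨⟨⟨σ, hσ, -⟩, -⟩, hS⟩, hacyc, -⟩ := hB
  have hempty : ∅ ∈ B.boundary (d + 1) :=
    FinComplex.down_closed _ σ hσ ∅ (Finset.empty_subset σ)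
  have hlink : ∀ X : FinComplex V, X.link ∅ = X := fun X =>
    ext_mem fun τ => by simp [mem_link]
  have hS := hS ∅ hempty
  have hacyc := hacyc ∅ hempty
  rw [hlink] at hS hacyc
  have hSB : ∀ σ ∈ B.boundary (d + 1), σ ∈ B := fun σ hσ => mem_generated_of_mem_boundary hσ
  constructor
  · obtain ⟨w, hw, hw0⟩ := exists_cycle_ne_zero (F := F) (X := B.boundary (d + 1)) (m := d + 1)
      (by rw [hS, if_pos (by simp)]; exact one_ne_zero)
    obtain ⟨z, hz, hzw⟩ := cycles_le_boundaries (hacyc (d + 1))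
      ⟨chains_mono hSB (d + 1) hw.1, hw.2⟩
    refine ⟨z, hz, ?_, hzw ▸ hw.1⟩
    rintro rfl
    rw [map_zero] at hzw
    exact hw0 hzw.symm
  · have hbα : chainBoundary F (Finsupp.single α (1 : F)) ∈ (B.boundary (d + 1)).cycles F d := by
      refine ⟨chainBoundary_single_mem_chains (fun v hv => hst _ (B.down_closed α hαB _
        (Finset.erase_subset v α)) ?_) hα 1, chainBoundary_chainBoundary F _⟩
      rw [Finset.card_erase_of_mem hv, hα]
      omega
    obtain ⟨c, hc, hcα⟩ := cycles_le_boundaries (by rw [hS, if_neg (by simp)]) hbα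
    have hcyc : Finsupp.single α (1 : F) - c ∈ B.cycles F (d + 1) := by
      refine ⟨sub_mem (single_mem_chains hαB hα 1) (chains_mono hSB (d + 1) hc), ?_⟩
      rw [SetLike.mem_coe, LinearMap.mem_ker, map_sub, hcα, sub_self]
    obtain ⟨e, he, hec⟩ := cycles_le_boundaries (hacyc (d + 1)) hcyc
    exact ⟨e, he, by rwa [hec, sub_sub_cancel]⟩

include hst in
/-- In a `1`-stacked homology ball, each interior ridge separates the two facets containing it. -/
lemma not_reflTransGen_ridgeAdj {α G G' : Finset V} (hα : α.card = d + 1)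
    (hG : G ∈ B.facesOfCard (d + 2)) (hG' : G' ∈ B.facesOfCard (d + 2)) (hαG : α ⊆ G)
    (hαG' : α ⊆ G') (hne : G ≠ G') :
    ¬ Relation.ReflTransGen (RidgeAdj (B.facesOfCard (d + 2)) (d + 1) (· ≠ α)) G G' := by
  intro hpath
  have hαB := B.down_closed G (mem_facesOfCard.1 hG).1 α hαG
  obtain ⟨⟨z, hz, hz0, hzb⟩, e, he, heb⟩ := exists_chains_of_ridge hB hst hαB hα
  have hcoeff : ∀ c ∈ B.chains F (d + 2), ∀ ρ : Finset V, ρ.card = d + 1 →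
      ∀ H ∈ B.facesOfCard (d + 2), ∀ H' ∈ B.facesOfCard (d + 2), ρ ⊆ H → ρ ⊆ H' → H ≠ H' →
      chainBoundary F c ρ = c H * chainBoundary F (Finsupp.single H 1) ρ +
        c H' * chainBoundary F (Finsupp.single H' 1) ρ := by
    intro c hc ρ hρ H hH H' hH' h h' hHH'
    refine chainBoundary_apply_of_two hHH' fun σ hσ hρσ => ?_
    by_contra! hcon
    exact hHH' (facet_eq_of_subset hB hρ (mem_facesOfCard.2 (mem_chains.1 hc σ hσ)) hH hH' hρσ h h'
      hcon.1 hcon.2)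
  have hunit : ∀ H ∈ B.facesOfCard (d + 2), ∀ ρ : Finset V, ρ.card = d + 1 → ρ ⊆ H →
      chainBoundary F (Finsupp.single H (1 : F)) ρ ≠ 0 := by
    intro H hH ρ hρ h
    refine chainBoundary_single_apply_ne_zero h ?_
    rw [(mem_facesOfCard.1 hH).2, hρ]
  have hvan : ∀ c ∈ (B.boundary (d + 1)).chains F (d + 1), ∀ ρ : Finset V, ρ.card = d + 1 →
      ∀ H ∈ B.facesOfCard (d + 2), ∀ H' ∈ B.facesOfCard (d + 2), ρ ⊆ H → ρ ⊆ H' → H ≠ H' →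
      c ρ = 0 := by
    intro c hc ρ hρ H hH H' hH' h h' hHH'
    by_contra hcon
    exact notMem_boundary_of_two hρ hH hH' h h' hHH' (mem_chains.1 hc ρ hcon).1
  -- Since `∂z` vanishes at interior ridges, a zero coefficient would spread to every facet and
  -- force `z = 0`.
  have hz1 : ∀ H ∈ B.facesOfCard (d + 2), z H ≠ 0 := by
    intro H hH hzH
    refine hz0 (Finsupp.ext fun K => ?_)
    by_contra hK
    have hconn := reflTransGen_ridgeAdj_star hB hst (d + 1) ∅ (by simp) H hH K
      (mem_facesOfCard.2 (mem_chains.1 hz K hK)) (by simp) (by simp)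
    refine hK ?_
    clear hK
    induction hconn with
    | refl => exact hzH
    | @tail M N _ hMN ih =>
      obtain ⟨hM, hN, ρ, -, hρ, hρM, hρN⟩ := hMN
      by_cases hMN : M = N
      · rw [← hMN, ih]
      have h1 := hcoeff z hz ρ hρ M hM N hN hρM hρN hMN
      rw [hvan _ hzb ρ hρ M hM N hN hρM hρN hMN, ih, Finsupp.zero_apply, zero_mul, zero_add] at h1
      exact (mul_eq_zero.1 h1.symm).resolve_right (hunit N hN ρ hρ hρN)
  -- Away from `α`, both chains satisfy the same two-term relation at each ridge crossed, so the
  -- ratio `e / z` is preserved.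
  have hratio : e G' = e G / z G * z G' := by
    clear hαG' hne hG'
    induction hpath with
    | refl => rw [div_mul_cancel₀ _ (hz1 G hG)]
    | @tail M N _ hMN ih =>
      obtain ⟨hM, hN, ρ, hρα, hρ, hρM, hρN⟩ := hMN
      by_cases hMN : M = N
      · rw [← hMN, ih]
      have h1 := hcoeff z hz ρ hρ M hM N hN hρM hρN hMN
      have h2 := hcoeff e he ρ hρ M hM N hN hρM hρN hMN
      rw [hvan _ hzb ρ hρ M hM N hN hρM hρN hMN] at h1
      have h3 := hvan _ heb ρ hρ M hM N hN hρM hρN hMN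
      rw [Finsupp.sub_apply, Finsupp.single_eq_of_ne hρα, zero_sub, neg_eq_zero, h2, ih] at h3
      refine mul_right_cancel₀ (hunit N hN ρ hρ hρN) ?_
      linear_combination h3 + e G / z G * h1
  -- At `α` itself `∂z` has coefficient 0 and `∂e` coefficient 1, impossible if `e` is a multiple of
  -- `z` on both facets.
  have h1 := hcoeff z hz α hα G hG G' hG' hαG hαG' hne
  have h2 := hcoeff e he α hα G hG G' hG' hαG hαG' hne
  rw [hvan _ hzb α hα G hG G' hG' hαG hαG' hne] at h1
  have h3 := hvan _ heb α hα G hG G' hG' hαG hαG' hne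
  rw [Finsupp.sub_apply, Finsupp.single_eq_same, h2, hratio] at h3
  have h4 : e G = e G / z G * z G := by rw [div_mul_cancel₀ _ (hz1 G hG)]
  rw [h4, div_mul_cancel₀ _ (hz1 G hG)] at h3
  have : (1 : F) = 0 := by
    linear_combination h3 - e G / z G * h1 +
      chainBoundary F (Finsupp.single G 1) α * h4
  exact one_ne_zero this

include hst in
/-- The facets of a `1`-stacked homology ball form a stacked family. -/
theorem isStackedFamily_facesOfCard : IsStackedFamily d (B.facesOfCard (d + 2)) := by
  obtain ⟨σ, hσ, hσc⟩ := hB.1.1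
  refine isStackedFamily_of_separating ⟨σ, mem_facesOfCard.2 ⟨hσ, hσc⟩⟩
    (fun G hG => (mem_facesOfCard.1 hG).2) ?_ ?_ ?_
  · exact fun ρ hρ G hG G₁ hG₁ G₂ hG₂ => facet_eq_of_subset hB hρ hG hG₁ hG₂
  · exact fun σ hσ => reflTransGen_ridgeAdj_star hB hst (d + 1 - σ.card) σ (by omega)
  · exact fun α hα G hG G' hG' => not_reflTransGen_ridgeAdj hB hst hα hG hG'

include hst in
lemma generated_facesOfCard : generated (B.facesOfCard (d + 2)) = B :=
  ext_mem fun _ => ⟨fun ⟨G, hG, hσ⟩ => B.down_closed G (mem_facesOfCard.1 hG).1 _ hσ,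
    exists_facet hB hst⟩

end StackedBallFacets

/-! ### The equivalence and the corollary -/

theorem isStellated_one_iff_isStackedSphere {V : Type*} [LinearOrder V] {d : ℕ}
    {S : FinComplex V} : IsStellated 1 d S ↔ IsStackedSphere 1 d S := by
  constructor
  · intro h
    obtain ⟨𝓕, h𝓕, rfl⟩ := exists_isStackedFamily_of_isStellated h
    exact h𝓕.isStackedSphere
  · rintro ⟨-, B, ⟨⟨F, _, hB⟩, hst⟩, rfl⟩
    have hst' : ∀ σ ∈ B, σ.card ≤ d → σ ∈ B.boundary (d + 1) :=
      fun σ hσ hc => hst σ hσ (Nat.succ_le_succ hc)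
    have h := (isStackedFamily_facesOfCard hB hst').isStellated
    rwa [generated_facesOfCard hB hst'] at h

end FinComplex

theorem corollary3 {V : Type*} [LinearOrder V] [Infinite V] :
    (∀ (d : ℕ) (S : FinComplex V), FinComplex.IsHomologySphere d S →
      (FinComplex.IsStellated 1 d S ↔ FinComplex.IsStackedSphere 1 d S)) ∧
    (∀ d : ℕ, FinComplex.stellatedSpheres V 1 d = FinComplex.stackedSpheres V 1 d) ∧
    (∀ d : ℕ, 1 ≤ d → FinComplex.classW V 1 d = FinComplex.classK V 1 d) := by
  have h : ∀ d : ℕ, FinComplex.stellatedSpheres V 1 d = FinComplex.stackedSpheres V 1 d :=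
    fun d => Set.ext fun _ => FinComplex.isStellated_one_iff_isStackedSphere
  refine ⟨fun d S _ => FinComplex.isStellated_one_iff_isStackedSphere, h, fun d _ => ?_⟩
  unfold FinComplex.classW FinComplex.classK
  rw [h]
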